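/- All $C^*$-algebras are complex and not necessarily unital. For $C^*$-algebras $A,B$, an $A$-$B$ Hilbert bimodule $A\to E\rightleftharpoons B$ is a right Hilbert $C^*$-module $E$ over $B$ (with $B$-valued inner product $\langle\cdot,\cdot\rangle_B$, conjugate-linear in the first and $B$-linear in the second variable, and $E$ complete in the norm $\|x\|=\|\langle x,x\rangle_B\|^{1/2}$) together with a $*$-homomorphism of $A$ into the adjointable operators on $E$ that is nondegenerate, i.e. the span of $AE$ is dense in $E$. Let $(A,B)$ be the category whose objects are the $A$-$B$ Hilbert bimodules and whose arrows $E\to F$ are the $A$-linear maps $T:E\to F$ that are adjointable, i.e. for which there is a map $S:F\to E$ with $\langle Tx,y\rangle_B=\langle x,Sy\rangle_B$ for all $x\in E$, $y\in F$. For $E\in(A,B)$ and $F\in(B,C)$ let $E\hat\otimes_B F\in(A,C)$ be Rieffel's interior tensor product: the Hausdorff completion of the algebraic tensor product $E\otimes_{\mathbb C}F$ in the $C$-valued semi-inner product $\langle x\otimes y,x'\otimes y'\rangle_C=\langle y,\langle x,x'\rangle_B\,y'\rangle_C$, with actions $a(x\otimes y)c=ax\otimes yc$. Let $1_B\in(B,B)$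 be $B$ itself, with $\langle b,b'\rangle_B=b^*b'$ and left and right multiplication as actions. **Theorem.** Every arrow $T$ of $(A,B)$ is a bimodule map: $T(xb)=T(x)b$ for $b\in B$. There is a bicategory $[\mathsf C^*]$ whose objects are all $C^*$-algebras, whose category of arrows for a pair $A,B$ is $(A,B)$, whose horizontal composition $(A,B)\times(B,C)\to(A,C)$ is $\hat\otimes_B$, and whose unit arrow in $(B,B)$ is $1_B$. Here horizontal composition of 2-cells is given on elementary tensors by $(S\hat\otimes T)(x\otimes y)=Sx\otimes Ty$, the associator by $(x\otimes y)\otimes z\mapsto x\otimes(y\otimes z)$, and the left and right unitors $1_A\hat\otimes_A E\cong E$ and $E\hat\otimes_B 1_B\cong E$ by $a\otimes x\mapsto ax$ and $x\otimes b\mapsto xb$. -/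

import Mathlib

universe w v u

open scoped TensorProduct ComplexConjugate

open CategoryTheory

namespace CStarBicat

section Positivity

variable {B : Type*} [NonUnitalCStarAlgebra B]

theorem pos_add {a b : B} (ha : ∃ c, a = star c * c) (hb : ∃ c, b = star c * c) :
    ∃ c, a + b = star c * c := by
  let _ := CStarAlgebra.spectralOrder B
  have := CStarAlgebra.spectralOrderedRing B
  rw [← CStarAlgebra.nonneg_iff_eq_star_mul_self] at *
  exact add_nonneg ha hb

theorem pos_sum {ι : Type*} (s : Finset ι) (f : ι → B)
    (h : ∀ i, ∃ c, f i = star c * c) : ∃ c, ∑ i ∈ s, f i = star c * c := by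
  classical
  induction s using Finset.induction_on with
  | empty => exact ⟨0, by simp⟩
  | insert i s hi ih => rw [Finset.sum_insert hi]; exact pos_add (h i) ih

theorem pos_of_conj {M : B} (hM : star M = M)
    (h : ∀ N K : B, star N = N → N * M * N = -(star K * K) → K = 0) :
    ∃ H, M = star H * H := by
  let _ := CStarAlgebra.spectralOrder B
  have := CStarAlgebra.spectralOrderedRing B
  rw [← CStarAlgebra.nonneg_iff_eq_star_mul_self,
    CStarAlgebra.nonneg_iff_isSelfAdjoint_and_negPart_eq_zero]
  refine ⟨hM, ?_⟩
  have hN0 : 0 ≤ M⁻ := CFC.negPart_nonneg M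
  have hNsa : star (M⁻) = M⁻ := (IsSelfAdjoint.of_nonneg hN0).star_eq
  have hMN : M⁻ * M * M⁻ = - (M⁻ * M⁻ * M⁻) := by
    have h1 : M⁻ * M = -(M⁻ * M⁻) := by
      have := congrArg (M⁻ * ·) (CFC.posPart_sub_negPart M hM)
      simpa [mul_sub, eq_comm] using this
    rw [h1, neg_mul]
  obtain ⟨K, hK⟩ : ∃ K : B, M⁻ * M⁻ * M⁻ = star K * K := by
    rw [← CStarAlgebra.nonneg_iff_eq_star_mul_self]
    have := star_left_conjugate_nonneg hN0 (M⁻)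
    rwa [hNsa] at this
  have hK0 := h _ K hNsa (hMN.trans (by rw [hK]))
  rw [hK0, mul_zero] at hK
  have h3 : star (M⁻ * M⁻) * (M⁻ * M⁻) = 0 := by
    rw [star_mul, hNsa, ← mul_assoc, hK, zero_mul]
  have h4 : star (M⁻) * M⁻ = 0 := by
    rw [hNsa]; exact (CStarRing.star_mul_self_eq_zero_iff _).mp h3
  exact (CStarRing.star_mul_self_eq_zero_iff _).mp h4

/-- A self-adjoint matrix over a C*-algebra that is positive as a quadratic form on columns is
of the form `H* H`. -/
theorem matrix_factor {n : Type*} [Fintype n] (G : n → n → B)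
    (hG : ∀ i j, star (G i j) = G j i)
    (hp : ∀ b : n → B, ∃ c, ∑ i, ∑ j, star (b i) * G i j * b j = star c * c) :
    ∃ H : n → n → B, ∀ i j, G i j = ∑ k, star (H k i) * H k j := by
  let _ := CStarAlgebra.spectralOrder B
  have := CStarAlgebra.spectralOrderedRing B
  have mul_app (P Q : CStarMatrix n n B) (i j : n) : (P * Q) i j = ∑ k, P i k * Q k j :=
    CStarMatrix.mul_apply
  have star_app (P : CStarMatrix n n B) (i j : n) : (star P) i j = star (P j i) := rfl
  let M : CStarMatrix n n B := CStarMatrix.ofMatrix (Matrix.of G)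
  have hMG (i j : n) : M i j = G i j := rfl
  obtain ⟨H, hH⟩ : ∃ H, M = star H * H := by
    refine pos_of_conj (by ext i j; exact hG j i) fun N K hNsa hMN => ?_
    have hdiag (k : n) : ∑ i, star (K i k) * K i k = 0 := by
      have h1 : (0 : B) ≤ (N * M * N) k k := by
        rw [CStarAlgebra.nonneg_iff_eq_star_mul_self]
        obtain ⟨c, hc⟩ := hp (fun i => N i k)
        refine ⟨c, hc ▸ ?_⟩
        simp only [mul_app, Finset.sum_mul]
        rw [Finset.sum_comm]
        refine Finset.sum_congr rfl fun i _ => Finset.sum_congr rfl fun j _ => ?_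
        rw [← star_app, hNsa, hMG]
      have h2 : (N * M * N) k k = - ∑ i, star (K i k) * K i k := by
        have h3 : (N * M * N) k k = - ((star K * K) k k) := congrFun (congrFun hMN k) k
        rw [h3, mul_app]
        simp only [star_app]
      rw [h2] at h1
      exact le_antisymm (neg_nonneg.mp h1)
        (Finset.sum_nonneg fun i _ => star_mul_self_nonneg (K i k))
    ext i k
    have h := (Finset.sum_eq_zero_iff_of_nonneg
      (fun i _ => star_mul_self_nonneg (K i k))).mp (hdiag k) i (Finset.mem_univ _)
    exact (CStarRing.star_mul_self_eq_zero_iff _).mp h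
  refine ⟨fun i j => H i j, fun i j => ?_⟩
  rw [← hMG, hH, mul_app]
  simp only [star_app]

/-- `‖a‖² - a* a` is, as an operator, a square `(‖a‖ - d)²` with `d` self-adjoint in `A`. -/
theorem exists_defect (a : B) : ∃ d : B, star d = d ∧
    star a * a = ((2 * ‖a‖ : ℝ) : ℂ) • d - d * d := by
  have hsa : IsSelfAdjoint (star a * a) := .star_mul_self a
  let f : ℝ → ℝ := fun t => ‖a‖ - √(‖a‖ ^ 2 - t)
  have hf0 : f 0 = 0 := by simp [f]
  have hfc : Continuous f := by fun_prop
  refine ⟨cfcₙ f (star a * a), (cfcₙ_predicate f (star a * a)).star_eq, ?_⟩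
  rw [Complex.coe_smul, ← cfcₙ_smul (2 * ‖a‖) f (star a * a), ← cfcₙ_mul f f (star a * a),
    ← cfcₙ_sub _ _ (star a * a)]
  conv_lhs => rw [← cfcₙ_id' ℝ (star a * a)]
  refine cfcₙ_congr fun t ht => ?_
  have : t ≤ ‖a‖ ^ 2 := by
    have h := NonUnitalIsometricContinuousFunctionalCalculus.norm_quasispectrum_le (star a * a) ht hsa
    rw [CStarRing.norm_star_mul_self, ← sq] at h
    exact (le_abs_self t).trans h
  have h2 := Real.sq_sqrt (sub_nonneg.mpr this)
  simp only [f, smul_eq_mul]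
  nlinarith

end Positivity

/-! ### Hilbert C*-modules -/

/-- A (right) Hilbert C*-module over a C*-algebra `B`: a complex vector space `E` with a compatible
right `B`-action, written `rsmul x b`, and a `B`-valued inner product, conjugate-linear in the first
and `B`-linear in the second variable, which is positive and such that `E` is complete in the norm
`‖x‖ = ‖⟪x, x⟫‖^(1/2)`. (Definiteness is part of `E` being a normed group.) Positivity of
`⟪x, x⟫` is expressed in the form `⟪x, x⟫ = c* c`. Mathlib's `CStarModule` is the analogous notion
for left modules. -/
class HilbertModule (B : Type*) [NonUnitalCStarAlgebra B] (E : Type*) [NormedAddCommGroup E]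
    [NormedSpace ℂ E] extends Inner B E where
  /-- the right action of `B` -/
  rsmul : E → B → E
  add_rsmul (x y : E) (b : B) : rsmul (x + y) b = rsmul x b + rsmul y b
  rsmul_add (x : E) (b c : B) : rsmul x (b + c) = rsmul x b + rsmul x c
  smul_rsmul (z : ℂ) (x : E) (b : B) : rsmul (z • x) b = z • rsmul x b
  rsmul_smul (z : ℂ) (x : E) (b : B) : rsmul x (z • b) = z • rsmul x b
  rsmul_mul (x : E) (b c : B) : rsmul x (b * c) = rsmul (rsmul x b) c
  inner_add_right (x y z : E) : inner x (y + z) = inner x y + inner x z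
  inner_smul_right (z : ℂ) (x y : E) : inner x (z • y) = z • inner x y
  inner_rsmul_right (x y : E) (b : B) : inner x (rsmul y b) = inner x y * b
  star_inner (x y : E) : star (inner x y) = inner y x
  inner_self_pos (x : E) : ∃ c : B, inner x x = star c * c
  norm_sq_eq (x : E) : ‖x‖ ^ 2 = ‖inner x x‖
  complete : CompleteSpace E

/-! ### Semi-inner products and their completion -/

/-- A right `C`-module `V` with a positive, possibly degenerate, `C`-valued inner product. -/
structure SemiInner (C : Type*) [NonUnitalCStarAlgebra C] (V : Type*) [AddCommGroup V]
    [Module ℂ V] where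
  form : V →ₗ⋆[ℂ] V →ₗ[ℂ] C
  rmul : C → V →ₗ[ℂ] V
  form_rmul (v w : V) (c : C) : form v (rmul c w) = form v w * c
  star_form (v w : V) : star (form v w) = form w v
  pos (v : V) : ∃ c, form v v = star c * c

namespace SemiInner

variable {C : Type*} [NonUnitalCStarAlgebra C] {V : Type*} [AddCommGroup V] [Module ℂ V]
  (S : SemiInner C V)

theorem rmul_form (v w : V) (c : C) : S.form (S.rmul c v) w = star c * S.form v w := by
  rw [← S.star_form, S.form_rmul, star_mul, S.star_form]

/-- The Cauchy-Schwarz inequality. -/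
theorem cauchy_schwarz (v w : V) : ‖S.form v w‖ ^ 2 ≤ ‖S.form v v‖ * ‖S.form w w‖ := by
  let _ := CStarAlgebra.spectralOrder C
  have := CStarAlgebra.spectralOrderedRing C
  have hp (u : V) : 0 ≤ S.form u u := CStarAlgebra.nonneg_iff_eq_star_mul_self.mpr (S.pos u)
  set b := S.form v w with hb
  have hb' : S.form w v = star b := by rw [hb, S.star_form]
  set M := ‖S.form v v‖
  have key (t : ℝ) : (2 * t - t ^ 2 * M) * ‖b‖ ^ 2 ≤ ‖S.form w w‖ := by
    by_cases ht : 2 * t - t ^ 2 * M ≤ 0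
    · exact (mul_nonpos_of_nonpos_of_nonneg ht (sq_nonneg _)).trans (norm_nonneg _)
    have h1 := hp ((t : ℂ) • S.rmul b v - w)
    have h2 : S.form ((t : ℂ) • S.rmul b v - w) ((t : ℂ) • S.rmul b v - w) =
        (t ^ 2) • (star b * S.form v v * b) - (2 * t) • (star b * b) + S.form w w := by
      simp only [map_sub, map_smulₛₗ, LinearMap.sub_apply, LinearMap.smul_apply, S.form_rmul,
        S.rmul_form, ← hb, hb', Complex.conj_ofReal, RingHom.id_apply]
      simp only [Complex.coe_smul, mul_assoc]
      module
    have h3 : star b * S.form v v * b ≤ M • (star b * b) :=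
      CStarAlgebra.star_left_conjugate_le_norm_smul (.of_nonneg (hp v))
    have h4 : (2 * t - t ^ 2 * M) • (star b * b) ≤ S.form w w := by
      rw [h2] at h1
      have h5 := smul_le_smul_of_nonneg_left h3 (sq_nonneg t)
      rw [sub_smul, mul_smul]
      rw [← sub_nonneg] at h5 ⊢
      convert add_nonneg h1 h5 using 1
      rw [smul_smul, ← mul_smul]
      abel
    have h5 := CStarAlgebra.norm_le_norm_of_nonneg_of_le
      (smul_nonneg (not_le.mp ht).le (star_mul_self_nonneg b)) h4
    rwa [norm_smul, Real.norm_of_nonneg (not_le.mp ht).le, CStarRing.norm_star_mul_self,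
      ← sq] at h5
  rcases (norm_nonneg (S.form v v)).eq_or_lt with hM | hM
  · have hM : M = 0 := hM.symm
    rw [hM, zero_mul]
    by_contra! hb0
    have := key ((‖S.form w w‖ + 1) / ‖b‖ ^ 2)
    rw [hM, mul_zero, sub_zero, mul_assoc, div_mul_cancel₀ _ hb0.ne'] at this
    linarith [norm_nonneg (S.form w w)]
  · have hM : 0 < M := hM
    have := key (1 / M)
    have h6 : 2 * (1 / M) - (1 / M) ^ 2 * M = 1 / M := by field_simp; norm_num
    rw [h6, one_div, inv_mul_le_iff₀ hM] at this
    exact this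

/-- The length `‖⟪v, v⟫‖^(1/2)` of a vector. -/
noncomputable def len (v : V) : ℝ := √‖S.form v v‖

theorem len_nonneg (v : V) : 0 ≤ S.len v := Real.sqrt_nonneg _

theorem len_sq (v : V) : S.len v ^ 2 = ‖S.form v v‖ := Real.sq_sqrt (norm_nonneg _)

theorem norm_form_le (v w : V) : ‖S.form v w‖ ≤ S.len v * S.len w := by
  refine abs_le_of_sq_le_sq' ?_ (mul_nonneg (S.len_nonneg v) (S.len_nonneg w)) |>.2
  rw [mul_pow, len_sq, len_sq]
  exact S.cauchy_schwarz v w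

theorem len_smul (z : ℂ) (v : V) : S.len (z • v) = ‖z‖ * S.len v := by
  have h : S.len (z • v) ^ 2 = (‖z‖ * S.len v) ^ 2 := by
    rw [mul_pow, len_sq, len_sq, map_smul, LinearMap.map_smulₛₗ, LinearMap.smul_apply, norm_smul,
      norm_smul, RCLike.norm_conj]
    ring
  exact (pow_left_inj₀ (S.len_nonneg _) (mul_nonneg (norm_nonneg _) (S.len_nonneg _))
    two_ne_zero).mp h

theorem len_add (v w : V) : S.len (v + w) ≤ S.len v + S.len w := by
  refine abs_le_of_sq_le_sq' ?_ (add_nonneg (S.len_nonneg v) (S.len_nonneg w)) |>.2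
  rw [len_sq, map_add, map_add, LinearMap.add_apply, LinearMap.add_apply]
  calc _ ≤ ‖S.form v v‖ + ‖S.form w v‖ + (‖S.form v w‖ + ‖S.form w w‖) :=
        (norm_add_le _ _).trans (add_le_add (norm_add_le _ _) (norm_add_le _ _))
    _ ≤ S.len v ^ 2 + S.len w * S.len v + (S.len v * S.len w + S.len w ^ 2) := by
        rw [len_sq, len_sq]
        gcongr <;> exact S.norm_form_le _ _
    _ = _ := by ring

/-- A copy of `V`, with the seminorm `‖⟪v, v⟫‖^(1/2)`. -/
@[nolint unusedArguments]
def Space (_ : SemiInner C V) : Type _ := V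

instance : AddCommGroup S.Space := inferInstanceAs (AddCommGroup V)
instance : Module ℂ S.Space := inferInstanceAs (Module ℂ V)

noncomputable instance : Norm S.Space := ⟨S.len⟩

theorem core : SeminormedSpace.Core ℂ S.Space where
  norm_nonneg := S.len_nonneg
  norm_smul := S.len_smul
  norm_triangle := S.len_add

noncomputable instance : SeminormedAddCommGroup S.Space := .ofCore S.core

noncomputable instance : NormedSpace ℂ S.Space where
  norm_smul_le z v := (S.core.norm_smul z v).le

/-- The Hausdorff completion of `V` in the seminorm `‖⟪v, v⟫‖^(1/2)`, i.e. the completion of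
the quotient of `V` by the vectors of length zero. -/
abbrev Compl : Type _ := UniformSpace.Completion S.Space

/-- The canonical map from `V` to its completion. -/
noncomputable def ι : V →ₗ[ℂ] S.Compl :=
  (UniformSpace.Completion.toComplL : S.Space →L[ℂ] S.Compl).toLinearMap

theorem norm_ι_sq (v : V) : ‖S.ι v‖ ^ 2 = ‖S.form v v‖ := by
  rw [← S.len_sq]
  exact congrArg (· ^ 2) (UniformSpace.Completion.norm_coe (E := S.Space) v)

theorem denseRange_ι : DenseRange S.ι :=
  UniformSpace.Completion.denseRange_coe (α := S.Space)

theorem denseRange_toComplL :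
    DenseRange (UniformSpace.Completion.toComplL : S.Space →L[ℂ] S.Compl) :=
  UniformSpace.Completion.denseRange_coe

theorem isUniformInducing_toComplL :
    IsUniformInducing (UniformSpace.Completion.toComplL : S.Space →L[ℂ] S.Compl) :=
  UniformSpace.Completion.isUniformInducing_coe _

/-- The extension to the completions of a bounded linear map. -/
noncomputable def extend (T : V →ₗ[ℂ] V) (K : ℝ)
    (hT : ∀ v, ‖S.form (T v) (T v)‖ ≤ K ^ 2 * ‖S.form v v‖) : S.Compl →L[ℂ] S.Compl :=
  let T₀ : S.Space →ₗ[ℂ] S.Space := T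
  let T₁ : S.Space →L[ℂ] S.Space := T₀.mkContinuous |K| fun v => by
    refine abs_le_of_sq_le_sq' ?_ (mul_nonneg (abs_nonneg K) (norm_nonneg v)) |>.2
    rw [mul_pow, sq_abs]
    exact (S.len_sq (T v)).trans_le ((hT v).trans_eq (congrArg _ (S.len_sq v).symm))
  ((UniformSpace.Completion.toComplL : S.Space →L[ℂ] S.Compl).comp T₁).extend
    UniformSpace.Completion.toComplL

theorem extend_ι (T : V →ₗ[ℂ] V) (K : ℝ)
    (hT : ∀ v, ‖S.form (T v) (T v)‖ ≤ K ^ 2 * ‖S.form v v‖) (v : V) :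
    S.extend T K hT (S.ι v) = S.ι (T v) :=
  ContinuousLinearMap.extend_eq (_ : S.Space →L[ℂ] S.Compl) S.denseRange_toComplL
    S.isUniformInducing_toComplL v

/-- The inner product on the semi-inner product space as a bounded sesquilinear map. -/
noncomputable def formL : S.Space →L⋆[ℂ] S.Space →L[ℂ] C :=
  let form₀ : S.Space →ₗ⋆[ℂ] S.Space →ₗ[ℂ] C := S.form
  form₀.mkContinuous₂ 1 fun v w => by rw [one_mul]; exact S.norm_form_le v w

/-- The inner product on the completion: the unique bounded sesquilinear map which extends
`S.form`. -/
noncomputable def innerL : S.Compl →L⋆[ℂ] S.Compl →L[ℂ] C :=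
  ((S.formL.extend UniformSpace.Completion.toComplL).flip.extend
    UniformSpace.Completion.toComplL).flip

@[simp]
theorem innerL_ι (v w : V) : S.innerL (S.ι v) (S.ι w) = S.form v w := by
  have h1 (u : S.Compl) := congrArg (fun f => f u) <| ContinuousLinearMap.extend_eq
    (S.formL.extend UniformSpace.Completion.toComplL).flip
    S.denseRange_toComplL S.isUniformInducing_toComplL w
  have h2 := congrArg (fun f => f w) <| ContinuousLinearMap.extend_eq
    S.formL S.denseRange_toComplL S.isUniformInducing_toComplL v
  exact (h1 (S.ι v)).trans h2

theorem bound_rmul (c : C) (v : V) :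
    ‖S.form (S.rmul c v) (S.rmul c v)‖ ≤ ‖c‖ ^ 2 * ‖S.form v v‖ := by
  rw [S.form_rmul, S.rmul_form]
  calc _ ≤ ‖star c‖ * ‖S.form v v‖ * ‖c‖ := 
        (norm_mul_le _ _).trans (by gcongr; exact norm_mul_le _ _)
    _ = _ := by rw [norm_star]; ring

/-- The right action on the completion. -/
noncomputable def rmulL (c : C) : S.Compl →L[ℂ] S.Compl :=
  S.extend (S.rmul c) ‖c‖ (S.bound_rmul c)

theorem rmulL_ι (c : C) (v : V) : S.rmulL c (S.ι v) = S.ι (S.rmul c v) := S.extend_ι _ _ _ _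

theorem star_innerL (x y : S.Compl) : star (S.innerL x y) = S.innerL y x := by
  induction x, y using S.denseRange_ι.induction_on₂ with
  | hp =>
    refine isClosed_eq ?_ ?_ <;> fun_prop
  | h v w => rw [innerL_ι, innerL_ι, S.star_form]

theorem innerL_rmulL (x y : S.Compl) (c : C) :
    S.innerL x (S.rmulL c y) = S.innerL x y * c := by
  induction x, y using S.denseRange_ι.induction_on₂ with
  | h v w => rw [innerL_ι, rmulL_ι, innerL_ι, S.form_rmul]
  | hp =>
    refine isClosed_eq ?_ ?_ <;> fun_prop

theorem norm_sq_compl (x : S.Compl) : ‖x‖ ^ 2 = ‖S.innerL x x‖ := by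
  induction x using S.denseRange_ι.induction_on with
  | ih v => rw [innerL_ι, norm_ι_sq]
  | hp => refine isClosed_eq ?_ ?_ <;> fun_prop

theorem innerL_pos (x : S.Compl) : ∃ c, S.innerL x x = star c * c := by
  let _ := CStarAlgebra.spectralOrder C
  have := CStarAlgebra.spectralOrderedRing C
  rw [← CStarAlgebra.nonneg_iff_eq_star_mul_self]
  induction x using S.denseRange_ι.induction_on with
  | ih v => rw [innerL_ι]; exact CStarAlgebra.nonneg_iff_eq_star_mul_self.mpr (S.pos v)
  | hp => exact CStarAlgebra.isClosed_nonneg.preimage (f := fun x => S.innerL x x) (by fun_prop)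

theorem ext_innerL {x y : S.Compl} (h : ∀ u, S.innerL u x = S.innerL u y) : x = y := by
  rw [← sub_eq_zero, ← norm_eq_zero, ← sq_eq_zero_iff, norm_sq_compl, map_sub, h, sub_self,
    norm_zero]

/-- The completion of a semi-inner product module is a Hilbert C*-module. -/
noncomputable instance : HilbertModule C S.Compl where
  inner x y := S.innerL x y
  rsmul x c := S.rmulL c x
  add_rsmul x y b := map_add _ _ _
  smul_rsmul z x b := map_smul _ _ _
  rsmul_add x b c := S.ext_innerL fun u => by
    simp only [map_add, innerL_rmulL, mul_add]
  rsmul_smul z x b := S.ext_innerL fun u => by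
    simp only [map_smul, innerL_rmulL, mul_smul_comm]
  rsmul_mul x b c := S.ext_innerL fun u => by
    simp only [innerL_rmulL, mul_assoc]
  inner_add_right x y z := map_add _ _ _
  inner_smul_right z x y := map_smul _ _ _
  inner_rsmul_right x y b := S.innerL_rmulL x y b
  star_inner x y := S.star_innerL x y
  inner_self_pos x := S.innerL_pos x
  norm_sq_eq x := S.norm_sq_compl x
  complete := inferInstance

variable {A : Type*} [NonUnitalCStarAlgebra A] (π : A →ₙₐ[ℂ] Module.End ℂ V)

/-- A *-representation of a C*-algebra on a semi-inner product module is contractive. -/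
theorem bound_rep (hπ : ∀ a v w, S.form (π a v) w = S.form v (π (star a) w)) (a : A) (v : V) :
    ‖S.form (π a v) (π a v)‖ ≤ ‖a‖ ^ 2 * ‖S.form v v‖ := by
  let _ := CStarAlgebra.spectralOrder C
  have := CStarAlgebra.spectralOrderedRing C
  have hp (u : V) : 0 ≤ S.form u u := CStarAlgebra.nonneg_iff_eq_star_mul_self.mpr (S.pos u)
  obtain ⟨d, hd, had⟩ := exists_defect a
  have h1 := hp ((‖a‖ : ℂ) • v - π d v)
  have h2 : S.form (π a v) (π a v) =
      ((2 * ‖a‖ : ℝ) : ℂ) • S.form v (π d v) - S.form v (π (d * d) v) := by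
    have : π (star a) (π a v) = π (star a * a) v := by rw [map_mul]; rfl
    rw [hπ, this, had, map_sub, map_smul, LinearMap.sub_apply, LinearMap.smul_apply, map_sub,
      map_smul]
  have h3 : S.form ((‖a‖ : ℂ) • v - π d v) ((‖a‖ : ℂ) • v - π d v) =
      (‖a‖ ^ 2) • S.form v v - S.form (π a v) (π a v) := by
    have h4 : π d (π d v) = π (d * d) v := by rw [map_mul]; rfl
    rw [h2]
    simp only [map_sub, map_smulₛₗ, LinearMap.sub_apply, LinearMap.smul_apply, hπ, hd, h4,
      Complex.conj_ofReal, RingHom.id_apply]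
    simp only [Complex.coe_smul]
    module
  rw [h3, sub_nonneg] at h1
  have h5 := CStarAlgebra.norm_le_norm_of_nonneg_of_le (hp _) h1
  rwa [norm_smul, Real.norm_of_nonneg (by positivity)] at h5

variable (hπ : ∀ a v w, S.form (π a v) w = S.form v (π (star a) w))

/-- The extension to the completion of a *-representation on a semi-inner product module. -/
noncomputable def extendRep : A →ₙₐ[ℂ] Module.End ℂ S.Compl where
  toFun a := (S.extend (π a) ‖a‖ (S.bound_rep π hπ a)).toLinearMap
  map_smul' z a := by
    ext x
    induction x using S.denseRange_ι.induction_on with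
    | ih v =>
      simp only [ContinuousLinearMap.coe_coe, LinearMap.smul_apply, extend_ι, map_smul,
        MonoidHom.id_apply]
    | hp =>
      refine isClosed_eq (by fun_prop) ?_
      exact (ContinuousLinearMap.continuous _).const_smul z
  map_zero' := by
    ext x
    induction x using S.denseRange_ι.induction_on with
    | ih v => simp only [ContinuousLinearMap.coe_coe, extend_ι, map_zero, LinearMap.zero_apply]
    | hp => exact isClosed_eq (by fun_prop) continuous_const
  map_add' a b := by
    ext x
    induction x using S.denseRange_ι.induction_on with
    | ih v => simp only [ContinuousLinearMap.coe_coe, extend_ι, map_add, LinearMap.add_apply]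
    | hp =>
      refine isClosed_eq (by fun_prop) ?_
      exact (ContinuousLinearMap.continuous _).add (ContinuousLinearMap.continuous _)
  map_mul' a b := by
    ext x
    induction x using S.denseRange_ι.induction_on with
    | ih v => simp only [ContinuousLinearMap.coe_coe, extend_ι, map_mul, Module.End.mul_apply]
    | hp =>
      refine isClosed_eq (by fun_prop) ?_
      exact (ContinuousLinearMap.continuous _).comp (ContinuousLinearMap.continuous _)

theorem extendRep_ι (a : A) (v : V) : S.extendRep π hπ a (S.ι v) = S.ι (π a v) :=
  S.extend_ι _ _ _ _

theorem continuous_extendRep (a : A) : Continuous (S.extendRep π hπ a) :=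
  (S.extend (π a) ‖a‖ (S.bound_rep π hπ a)).continuous

theorem innerL_extendRep (a : A) (x y : S.Compl) :
    S.innerL (S.extendRep π hπ a x) y = S.innerL x (S.extendRep π hπ (star a) y) := by
  have := S.continuous_extendRep π hπ
  induction x, y using S.denseRange_ι.induction_on₂ with
  | h v w => rw [extendRep_ι, extendRep_ι, innerL_ι, innerL_ι, hπ]
  | hp => refine isClosed_eq ?_ ?_ <;> fun_prop

end SemiInner

/-! ### C*-algebras, Hilbert bimodules and adjointable maps -/



/-- A C*-algebra (complex, not necessarily unital). -/
structure CStarAlg : Type (u + 1) where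
  carrier : Type u
  [str : NonUnitalCStarAlgebra carrier]

attribute [instance] CStarAlg.str

instance : CoeSort CStarAlg.{u} (Type u) := ⟨CStarAlg.carrier⟩

/-- An `A`-`B` Hilbert bimodule: a Hilbert C*-module `E` over `B` with a nondegenerate
*-homomorphism of `A` into the adjointable operators on `E`. The *-homomorphism is given as a
homomorphism `a ↦ leftAction a` into the linear operators on `E`, such that `leftAction a` is
adjointable with adjoint `leftAction a*`. It is nondegenerate if the span of the vectors `a x` is
dense in `E`. -/
structure HilbertBimodule (A B : CStarAlg.{u}) : Type (u + 1) where
  carrier : Type u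
  [normedAddCommGroup : NormedAddCommGroup carrier]
  [normedSpace : NormedSpace ℂ carrier]
  [hilbertModule : HilbertModule B carrier]
  leftAction : A →ₙₐ[ℂ] Module.End ℂ carrier
  inner_leftAction (a : A) (x y : carrier) :
    inner B (leftAction a x) y = inner B x (leftAction (star a) y)
  nondegenerate :
    Dense (Submodule.span ℂ {z : carrier | ∃ a x, leftAction a x = z} : Set carrier)

attribute [instance] HilbertBimodule.normedAddCommGroup HilbertBimodule.normedSpace
  HilbertBimodule.hilbertModule

instance (A B : CStarAlg.{u}) : CoeSort (HilbertBimodule A B) (Type u) :=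
  ⟨HilbertBimodule.carrier⟩

/-- A 2-cell: an `A`-linear map `T : E → F` between `A`-`B` Hilbert bimodules which is adjointable,
i.e. there is a map `S : F → E` with `⟪T x, y⟫ = ⟪x, S y⟫`. -/
@[ext]
structure BimoduleMap {A B : CStarAlg.{u}} (E F : HilbertBimodule A B) : Type u
    extends E →ₗ[ℂ] F where
  map_leftAction (a : A) (x : E) : toFun (E.leftAction a x) = F.leftAction a (toFun x)
  adjointable : ∃ S : F → E, ∀ (x : E) (y : F), inner B (toFun x) y = inner B x (S y)

instance {A B : CStarAlg.{u}} (E F : HilbertBimodule A B) :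
    CoeFun (BimoduleMap E F) (fun _ => E → F) := ⟨fun T => T.toFun⟩

/-- The category `(A, B)` of Hilbert bimodules and adjointable `A`-linear maps. -/
instance homCategory (A B : CStarAlg.{u}) : CategoryTheory.Category (HilbertBimodule A B) where
  Hom E F := BimoduleMap E F
  id E :=
    { toLinearMap := LinearMap.id
      map_leftAction := fun _ _ => rfl
      adjointable := ⟨id, fun _ _ => rfl⟩ }
  comp S T :=
    { toLinearMap := T.toLinearMap ∘ₗ S.toLinearMap
      map_leftAction := fun a x =>
        (congrArg T.toFun (S.map_leftAction a x)).trans (T.map_leftAction a _)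
      adjointable := by
        obtain ⟨S', hS⟩ := S.adjointable
        obtain ⟨T', hT⟩ := T.adjointable
        exact ⟨S' ∘ T', fun x y => (hT _ _).trans (hS _ _)⟩ }

/-! ### The canonical bimodule -/

/-- A C*-algebra as a Hilbert C*-module over itself, with `⟪a, b⟫ = a* b`. -/
noncomputable instance selfModule (B : Type*) [NonUnitalCStarAlgebra B] : HilbertModule B B where
  inner a b := star a * b
  rsmul a b := a * b
  add_rsmul := add_mul
  rsmul_add := mul_add
  smul_rsmul := smul_mul_assoc
  rsmul_smul z x b := mul_smul_comm z x b
  rsmul_mul x b c := (mul_assoc x b c).symm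
  inner_add_right x := mul_add (star x)
  inner_smul_right z x y := mul_smul_comm z (star x) y
  inner_rsmul_right x y b := (mul_assoc (star x) y b).symm
  star_inner x y := by rw [star_mul, star_star]
  inner_self_pos x := ⟨x, rfl⟩
  norm_sq_eq x := by rw [CStarRing.norm_star_mul_self, sq]
  complete := inferInstance

/-- The canonical bimodule `B → B ⇌ B`, with left and right multiplication as actions. -/
noncomputable def unitBimodule (B : CStarAlg.{u}) : HilbertBimodule B B where
  carrier := B
  leftAction := NonUnitalAlgHom.lmul ℂ B
  inner_leftAction a x y := by
    change star (a * x) * y = star x * (star a * y)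
    rw [star_mul, mul_assoc]
  nondegenerate := by
    let _ := CStarAlgebra.spectralOrder B
    have := CStarAlgebra.spectralOrderedRing B
    have h := CStarAlgebra.increasingApproximateUnit B
    have := h.toIsApproximateUnit.neBot
    intro x
    refine mem_closure_of_tendsto (h.toIsApproximateUnit.tendsto_mul_right x)
      (Filter.Eventually.of_forall fun e => Submodule.subset_span ⟨e, x, rfl⟩)

/-! ### The interior tensor product -/

namespace HilbertModule

variable {B : Type*} [NonUnitalCStarAlgebra B] {E : Type*} [NormedAddCommGroup E]
    [NormedSpace ℂ E] [HilbertModule B E]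

theorem inner_add_left (x y z : E) : inner B (x + y) z = inner B x z + inner B y z := by
  rw [← star_inner, inner_add_right, star_add, star_inner, star_inner]

theorem inner_smul_left (z : ℂ) (x y : E) : inner B (z • x) y = conj z • inner B x y := by
  rw [← star_inner, inner_smul_right, star_smul, star_inner]; rfl

variable (B E) in
/-- A Hilbert C*-module as a semi-inner product module. -/
noncomputable def toSemiInner : SemiInner B E where
  form := LinearMap.mk₂'ₛₗ (starRingEnd ℂ) (RingHom.id ℂ) (fun x y => inner B x y)
    inner_add_left inner_smul_left inner_add_right inner_smul_right
  rmul b :=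
    { toFun := fun x => rsmul x b
      map_add' := fun x y => add_rsmul x y b
      map_smul' := fun z x => smul_rsmul z x b }
  form_rmul v w c := inner_rsmul_right v w c
  star_form := star_inner
  pos := inner_self_pos

theorem norm_inner_le (x y : E) : ‖(inner B x y : B)‖ ≤ ‖x‖ * ‖y‖ := by
  refine abs_le_of_sq_le_sq' ?_ (by positivity) |>.2
  rw [mul_pow, norm_sq_eq (B := B) x, norm_sq_eq (B := B) y]
  exact (toSemiInner B E).cauchy_schwarz x y

variable (B) in
theorem ext_inner {x y : E} (h : ∀ u : E, (inner B u x : B) = inner B u y) : x = y := by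
  have h1 (u v w : E) : (inner B u (v - w) : B) = inner B u v - inner B u w :=
    map_sub ((toSemiInner B E).form u) v w
  rw [← sub_eq_zero, ← norm_eq_zero, ← sq_eq_zero_iff, norm_sq_eq (B := B), h1, h, sub_self,
    norm_zero]

end HilbertModule

namespace HilbertBimodule

variable {A B C : CStarAlg.{u}}

theorem norm_leftAction_le (E : HilbertBimodule A B) (a : A) (x : E) :
    ‖E.leftAction a x‖ ≤ ‖a‖ * ‖x‖ := by
  refine abs_le_of_sq_le_sq' ?_ (by positivity) |>.2
  rw [mul_pow, HilbertModule.norm_sq_eq (B := B) x, HilbertModule.norm_sq_eq (B := B)]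
  exact (HilbertModule.toSemiInner B E).bound_rep E.leftAction E.inner_leftAction a x

theorem leftAction_rsmul (E : HilbertBimodule A B) (a : A) (x : E) (b : B) :
    E.leftAction a (HilbertModule.rsmul x b) = HilbertModule.rsmul (E.leftAction a x) b := by
  refine HilbertModule.ext_inner B fun u => ?_
  have h := E.inner_leftAction (star a) u
  simp only [star_star] at h
  rw [← h, HilbertModule.inner_rsmul_right, HilbertModule.inner_rsmul_right, h]

theorem inner_leftAction_mul (E : HilbertBimodule A B) (a a' : A) (x y : E) :
    (inner B x (E.leftAction (star a * a') y) : B) =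
      inner B (E.leftAction a x) (E.leftAction a' y) := by
  rw [map_mul, inner_leftAction]; rfl

section Tensor

variable (E : HilbertBimodule A B) (F : HilbertBimodule B C)

/-- The sesquilinear form `⟪x ⊗ y, x' ⊗ y'⟫ = ⟪y, ⟪x, x'⟫ y'⟫` on `E ⊗ F`. -/
noncomputable def tensorForm : E ⊗[ℂ] F →ₗ⋆[ℂ] E ⊗[ℂ] F →ₗ[ℂ] C :=
  TensorProduct.lift <| LinearMap.mk₂'ₛₗ (starRingEnd ℂ) (starRingEnd ℂ)
    (fun x y => TensorProduct.lift <| LinearMap.mk₂ ℂ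
      (fun x' y' => inner C y (F.leftAction (inner B x x') y'))
      (fun _ _ _ => by
        rw [HilbertModule.inner_add_right, map_add, LinearMap.add_apply,
          HilbertModule.inner_add_right])
      (fun _ _ _ => by
        rw [HilbertModule.inner_smul_right, map_smul, LinearMap.smul_apply,
          HilbertModule.inner_smul_right])
      (fun _ _ _ => by rw [map_add, HilbertModule.inner_add_right])
      (fun _ _ _ => by rw [map_smul, HilbertModule.inner_smul_right]))
    (fun _ _ _ => TensorProduct.ext' fun _ _ => by
      simp [HilbertModule.inner_add_left, HilbertModule.inner_add_right])
    (fun _ _ _ => TensorProduct.ext' fun _ _ => by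
      simp [HilbertModule.inner_smul_left, HilbertModule.inner_smul_right])
    (fun _ _ _ => TensorProduct.ext' fun _ _ => by
      simp [HilbertModule.inner_add_left])
    (fun _ _ _ => TensorProduct.ext' fun _ _ => by
      simp [HilbertModule.inner_smul_left])

theorem tensorForm_tmul (x x' : E) (y y' : F) :
    tensorForm E F (x ⊗ₜ y) (x' ⊗ₜ y') = inner C y (F.leftAction (inner B x x') y') := rfl

theorem star_tensorForm (s t : E ⊗[ℂ] F) : star (tensorForm E F s t) = tensorForm E F t s := by
  induction s with
  | zero => simp
  | add s s' h h' => simp [h, h']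
  | tmul x y =>
    induction t with
    | zero => simp
    | add t t' h h' => simp [h, h']
    | tmul x' y' =>
      rw [tensorForm_tmul, tensorForm_tmul, HilbertModule.star_inner, inner_leftAction,
        HilbertModule.star_inner]

theorem tensorForm_pos (t : E ⊗[ℂ] F) : ∃ c, tensorForm E F t t = star c * c := by
  obtain ⟨s, rfl⟩ := TensorProduct.exists_finset t
  have hin (S : SemiInner B E) (b : s → B) :
      ∑ i : s, ∑ j : s, star (b i) * S.form i.1.1 j.1.1 * b j =
        S.form (∑ i : s, S.rmul (b i) i.1.1) (∑ i : s, S.rmul (b i) i.1.1) := by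
    simp only [map_sum, LinearMap.sum_apply, S.form_rmul, S.rmul_form]
    exact Finset.sum_comm
  obtain ⟨H, hH⟩ := matrix_factor (fun i j : s => (inner B i.1.1 j.1.1 : B))
    (fun i j => HilbertModule.star_inner _ _)
    (fun b => by
      obtain ⟨c, hc⟩ := (HilbertModule.toSemiInner B E).pos
        (∑ i : s, (HilbertModule.toSemiInner B E).rmul (b i) i.1.1)
      exact ⟨c, (hin _ b).trans hc⟩)
  have hF := (HilbertModule.toSemiInner C F).pos
  have hform (y y' : F) : (inner C y y' : C) = (HilbertModule.toSemiInner C F).form y y' := rfl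
  suffices h : tensorForm E F (∑ i ∈ s, i.1 ⊗ₜ i.2) (∑ i ∈ s, i.1 ⊗ₜ i.2) =
      ∑ k : s, (HilbertModule.toSemiInner C F).form (∑ j : s, F.leftAction (H k j) j.1.2)
        (∑ j : s, F.leftAction (H k j) j.1.2) by
    rw [h]
    exact pos_sum _ _ fun k => hF _
  have hsum (i j : s) : (inner C j.1.2 (F.leftAction (inner B j.1.1 i.1.1) i.1.2) : C) =
      ∑ k : s, (HilbertModule.toSemiInner C F).form (F.leftAction (H k j) j.1.2)
        (F.leftAction (H k i) i.1.2) := by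
    simp only [← hform, ← inner_leftAction_mul]
    rw [hH, map_sum, LinearMap.sum_apply, hform, map_sum]
    rfl
  rw [← Finset.sum_coe_sort s]
  simp only [map_sum, LinearMap.sum_apply, tensorForm_tmul, hsum]
  rw [Finset.sum_congr rfl fun i _ => Finset.sum_comm, Finset.sum_comm]

/-- The algebraic tensor product with its semi-inner product and the right action
`(x ⊗ y) c = x ⊗ y c`. -/
noncomputable def tensorSemiInner : SemiInner C (E ⊗[ℂ] F) where
  form := tensorForm E F
  rmul c := ((HilbertModule.toSemiInner C F).rmul c).lTensor E
  form_rmul s t c := by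
    induction s with
    | zero => simp
    | add s s' h h' => simp [h, h', add_mul]
    | tmul x y =>
      induction t with
      | zero => simp
      | add t t' h h' => simp [h, h', add_mul]
      | tmul x' y' =>
        rw [LinearMap.lTensor_tmul, tensorForm_tmul, tensorForm_tmul]
        have (z : F) : F.leftAction (inner B x x') ((HilbertModule.toSemiInner C F).rmul c z) =
          (HilbertModule.toSemiInner C F).rmul c (F.leftAction (inner B x x') z) :=
          F.leftAction_rsmul _ z c
        rw [this]
        exact HilbertModule.inner_rsmul_right _ _ _
  star_form := star_tensorForm E F
  pos := tensorForm_pos E F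

/-- The left action `a (x ⊗ y) = a x ⊗ y` on the algebraic tensor product. -/
noncomputable def tensorRep : A →ₙₐ[ℂ] Module.End ℂ (E ⊗[ℂ] F) :=
  ((Module.End.rTensorAlgHom ℂ E F : Module.End ℂ E →ₐ[ℂ] Module.End ℂ (E ⊗[ℂ] F)) :
    Module.End ℂ E →ₙₐ[ℂ] Module.End ℂ (E ⊗[ℂ] F)).comp E.leftAction

theorem tensorRep_tmul (a : A) (x : E) (y : F) :
    tensorRep E F a (x ⊗ₜ y) = E.leftAction a x ⊗ₜ y := rfl

theorem tensorForm_tensorRep (a : A) (s t : E ⊗[ℂ] F) :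
    tensorForm E F (tensorRep E F a s) t = tensorForm E F s (tensorRep E F (star a) t) := by
  induction s with
  | zero => simp
  | add s s' h h' => simp [h, h']
  | tmul x y =>
    induction t with
    | zero => simp
    | add t t' h h' => simp [h, h']
    | tmul x' y' =>
      rw [tensorRep_tmul, tensorRep_tmul, tensorForm_tmul, tensorForm_tmul, inner_leftAction]

theorem norm_ι_tmul_le (x : E) (y : F) :
    ‖(tensorSemiInner E F).ι (x ⊗ₜ y)‖ ≤ ‖y‖ * ‖x‖ := by
  refine abs_le_of_sq_le_sq' ?_ (by positivity) |>.2
  rw [SemiInner.norm_ι_sq]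
  calc ‖(inner C y (F.leftAction (inner B x x) y) : C)‖
      ≤ ‖y‖ * ‖F.leftAction (inner B x x) y‖ := HilbertModule.norm_inner_le _ _
    _ ≤ ‖y‖ * (‖(inner B x x : B)‖ * ‖y‖) := by gcongr; exact F.norm_leftAction_le _ _
    _ = (‖y‖ * ‖x‖) ^ 2 := by rw [← HilbertModule.norm_sq_eq]; ring

theorem tensor_nondegenerate : Dense (Submodule.span ℂ {z | ∃ a x, (tensorSemiInner E F).extendRep
    (tensorRep E F) (tensorForm_tensorRep E F) a x = z} : Set (tensorSemiInner E F).Compl) := by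
  set W := Submodule.span ℂ {z | ∃ a x, (tensorSemiInner E F).extendRep
    (tensorRep E F) (tensorForm_tensorRep E F) a x = z}
  have key (t : E ⊗[ℂ] F) : (tensorSemiInner E F).ι t ∈ W.topologicalClosure := by
    induction t with
    | zero => rw [map_zero]; exact zero_mem _
    | add t t' h h' => rw [map_add]; exact add_mem h h'
    | tmul x y =>
      let L : E →L[ℂ] (tensorSemiInner E F).Compl := LinearMap.mkContinuous
        ((tensorSemiInner E F).ι ∘ₗ (TensorProduct.mk ℂ E F).flip y) ‖y‖
        fun x => norm_ι_tmul_le E F x y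
      have hL : Set.MapsTo L (Submodule.span ℂ {z : E | ∃ a x, E.leftAction a x = z}) W := by
        suffices h : Submodule.span ℂ {z : E | ∃ a x, E.leftAction a x = z} ≤
          W.comap L.toLinearMap from h
        rw [Submodule.span_le]
        rintro _ ⟨a, z, rfl⟩
        exact Submodule.subset_span ⟨a, (tensorSemiInner E F).ι (z ⊗ₜ y),
          SemiInner.extendRep_ι _ _ _ _ _⟩
      have h3 : L x ∈ closure (W : Set (tensorSemiInner E F).Compl) :=
        map_mem_closure L.continuous (E.nondegenerate x) hL
      exact h3
  have h2 : Dense (W.topologicalClosure : Set (tensorSemiInner E F).Compl) :=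
    (tensorSemiInner E F).denseRange_ι.mono (by rintro _ ⟨t, rfl⟩; exact key t)
  rw [Submodule.topologicalClosure_coe] at h2
  exact dense_closure.mp h2

/-- Rieffel's interior tensor product `E ⊗̂ F` of Hilbert bimodules: the (Hausdorff) completion
of the algebraic tensor product in the inner product `⟪x ⊗ y, x' ⊗ y'⟫ = ⟪y, ⟪x, x'⟫ y'⟫`, with
the actions `a (x ⊗ y) c = a x ⊗ y c`. -/
noncomputable def tensor : HilbertBimodule A C where
  carrier := (tensorSemiInner E F).Compl
  leftAction := (tensorSemiInner E F).extendRep (tensorRep E F) (tensorForm_tensorRep E F)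
  inner_leftAction a x y := (tensorSemiInner E F).innerL_extendRep _ _ a x y
  nondegenerate := tensor_nondegenerate E F

/-- The elementary tensor `x ⊗ y` in `E ⊗̂ F`. -/
noncomputable def tmul {E : HilbertBimodule A B} {F : HilbertBimodule B C} (x : E) (y : F) :
    E.tensor F :=
  (tensorSemiInner E F).ι (x ⊗ₜ y)

end Tensor

end HilbertBimodule

/-! ### Bicategories with prescribed data -/

/-- The data (without the axioms) of a bicategory with objects `X`, in the sense of Mathlib's
`Bicategory`: 1-cells and their identities and composition, categories of 1-cells, whiskering
(i.e. horizontal composition of 2-cells with identity 2-cells), associators and unitors. -/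
structure BicategoryData (X : Type*) extends CategoryStruct.{v} X where
  homCategory : ∀ a b : X, Category.{w} (a ⟶ b)
  whiskerLeft {a b c : X} (f : a ⟶ b) {g h : b ⟶ c} (η : g ⟶ h) : f ≫ g ⟶ f ≫ h
  whiskerRight {a b c : X} {f g : a ⟶ b} (η : f ⟶ g) (h : b ⟶ c) : f ≫ h ⟶ g ≫ h
  associator {a b c d : X} (f : a ⟶ b) (g : b ⟶ c) (h : c ⟶ d) : (f ≫ g) ≫ h ≅ f ≫ g ≫ h
  leftUnitor {a b : X} (f : a ⟶ b) : 𝟙 a ≫ f ≅ f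
  rightUnitor {a b : X} (f : a ⟶ b) : f ≫ 𝟙 b ≅ f

/-- The data underlying a bicategory. -/
def BicategoryData.of {X : Type*} (𝓑 : Bicategory.{w, v} X) :
    BicategoryData.{w, v} X where
  toCategoryStruct := 𝓑.toCategoryStruct
  homCategory := 𝓑.homCategory
  whiskerLeft := 𝓑.whiskerLeft
  whiskerRight := 𝓑.whiskerRight
  associator := 𝓑.associator
  leftUnitor := 𝓑.leftUnitor
  rightUnitor := 𝓑.rightUnitor

/-- The value `T x` of a 2-cell `T` at a vector `x`. -/
def app {A B : CStarAlg.{u}} {E F : HilbertBimodule A B} (T : E ⟶ F) (x : E) : F :=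
  BimoduleMap.toLinearMap T x

end CStarBicat

open CategoryTheory CStarBicat HilbertBimodule

namespace CStarBicat

/-! Every structural 2-cell is prescribed on a total family of vectors (elementary tensors, possibly
iterated), and the one analytic problem is to extend it. `exists_hom` does this uniformly. Let `p`
and `q` be total families in `E` and `F`, and let `τ`, `σ` be maps of indices that are adjoint for
the inner products. On formal linear combinations write D for the map induced by `σ ∘ τ`, the
would-be T*T. It is symmetric, so a n = ‖Dⁿv‖ satisfies (a n)² = ‖⟪v, D²ⁿv⟫‖ ≤ a 0 · a (2n). If a
grows at most like Mⁿ, with a constant that may depend on v, then a 1 ≤ M · a 0, hence ‖Tv‖² = ‖⟪v,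
Dv⟫‖ ≤ M‖v‖². This gives well-definedness and boundedness together, without any positivity argument
for operator matrices.

For whiskering, the growth rate comes from ‖x ⊗ y‖ ≤ ‖x‖‖y‖ and the iterates of ST, where S is the
adjoint of T. For associators and unitors `τ` and `σ` are identities, and it is enough to match
inner products (`exists_iso`). Totality of the vectors ax is nondegeneracy; totality of the vectors
xb comes from an approximate unit.

Adjointable maps are automatically right linear, and bounded by the closed graph theorem. So
equalities of 2-cells, in particular all bicategory axioms, can be checked on elementary tensors.
There naturality of the unitors is left and right linearity, and the triangle is the balancing
relation xb ⊗ y = x ⊗ by. -/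

/-- A log-convexity estimate: if `a n ^ 2 ≤ a 0 * a (2 n)` and `a` grows at most like `M ^ n`,
then `a 1 ≤ M * a 0`. -/
theorem le_mul_of_sq_le_of_growth {a : ℕ → ℝ} (h0 : 0 ≤ a 0)
    (hsq : ∀ n, a n ^ 2 ≤ a 0 * a (2 * n)) {M : ℝ} (hM : 0 < M)
    (hgrowth : ∃ K, ∀ n, a n ≤ K * M ^ n) : a 1 ≤ M * a 0 := by
  obtain ⟨K, hK⟩ := hgrowth
  by_contra! hlt
  have h1 : 0 < a 1 := (mul_nonneg hM.le h0).trans_lt hlt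
  rcases h0.eq_or_lt with h | h
  · have := hsq 1
    rw [← h, zero_mul] at this
    exact absurd this (not_le.mpr (by positivity))
  set r := a 1 / a 0 with hr
  have hr0 : 0 < r := div_pos h1 h
  have hrM : 1 < r / M := by rwa [one_lt_div hM, hr, lt_div_iff₀ h]
  -- The hypothesis only relates index n to 2n, so the geometric lower bound is propagated along
  -- powers of two. Its rate r exceeds M, which no constant `K` can absorb.
  have key (k : ℕ) : a 0 * r ^ 2 ^ k ≤ a (2 ^ k) := by
    induction k with
    | zero => rw [pow_zero, pow_one, hr, mul_div_cancel₀ _ h.ne']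
    | succ k ih =>
      have h2 : (a 0 * r ^ 2 ^ k) ^ 2 ≤ a 0 * a (2 * 2 ^ k) :=
        (pow_le_pow_left₀ (by positivity) ih 2).trans (hsq _)
      rw [mul_pow, ← pow_mul, sq, mul_assoc] at h2
      have h3 := le_of_mul_le_mul_left h2 h
      rwa [← pow_succ, ← pow_succ'] at h3
  obtain ⟨n, hn⟩ := pow_unbounded_of_one_lt (K / a 0) hrM
  have h2 : (r / M) ^ n ≤ (r / M) ^ 2 ^ n := pow_le_pow_right₀ hrM.le n.lt_two_pow_self.le
  have h3 : (r / M) ^ 2 ^ n ≤ K / a 0 := by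
    rw [div_pow, div_le_div_iff₀ (by positivity) h, mul_comm]
    exact (key n).trans (hK _)
  linarith

/-! ### Hilbert modules: automatic linearity and continuity of adjointable maps, totality of the
vectors xb. -/

namespace HilbertModule

variable {B : Type*} [NonUnitalCStarAlgebra B] {E : Type*} [NormedAddCommGroup E]
    [NormedSpace ℂ E] [HilbertModule B E]

variable (B E) in
/-- The inner product as a bounded sesquilinear map. -/
noncomputable def innerSL : E →L⋆[ℂ] E →L[ℂ] B :=
  (toSemiInner B E).form.mkContinuous₂ 1 fun x y => by rw [one_mul]; exact norm_inner_le x y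

theorem innerSL_apply (x y : E) : innerSL B E x y = inner B x y := rfl

theorem inner_sub_right (x y z : E) :
    (inner B x (y - z) : B) = inner B x y - inner B x z :=
  map_sub (innerSL B E x) y z

theorem inner_rsmul_left (x y : E) (b : B) :
    (inner B (rsmul x b) y : B) = star b * inner B x y :=
  (toSemiInner B E).rmul_form x y b

variable {F : Type*} [NormedAddCommGroup F] [NormedSpace ℂ F] [HilbertModule B F]

/-- Adjointable linear maps are linear over the right action. -/
theorem map_rsmul_of_adjoint {T : E → F} {S : F → E}
    (h : ∀ x y, (inner B (T x) y : B) = inner B x (S y)) (x : E) (b : B) :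
    T (rsmul x b) = rsmul (T x) b := by
  refine ext_inner B fun u => ?_
  -- Moving `T` to the other side leaves only the right linearity of the inner product in its second
  -- variable.
  have h' (z : E) : (inner B u (T z) : B) = inner B (S u) z := by
    rw [← star_inner, h, star_inner]
  rw [h', inner_rsmul_right, inner_rsmul_right, h']

/-- The adjoint of a map is linear. -/
theorem exists_linear_adjoint {T : E → F} {S : F → E}
    (h : ∀ x y, (inner B (T x) y : B) = inner B x (S y)) : ∃ S' : F →ₗ[ℂ] E, ⇑S' = S :=
  ⟨{ toFun := S
     map_add' := fun x y => ext_inner B fun u => by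
      rw [← h, inner_add_right, inner_add_right, h, h]
     map_smul' := fun z x => ext_inner B fun u => by
      rw [← h, inner_smul_right, RingHom.id_apply, inner_smul_right, h] }, rfl⟩

/-- Adjointable linear maps are bounded. -/
theorem continuous_of_adjoint {T : E →ₗ[ℂ] F} {S : F → E}
    (h : ∀ x y, (inner B (T x) y : B) = inner B x (S y)) : Continuous T := by
  have := complete B (E := E)
  have := complete B (E := F)
  -- Closed graph theorem: if fₙ → x and Tfₙ → y, then ⟪u, y⟫ = lim ⟪Su, fₙ⟫ = ⟪Su, x⟫ = ⟪u, Tx⟫ for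
  -- every u.
  refine T.continuous_of_seq_closed_graph fun f x y hf hTf => ext_inner B fun u => ?_
  have h' (z : E) : innerSL B F u (T z) = innerSL B E (S u) z := by
    rw [innerSL_apply, innerSL_apply, ← star_inner, h, star_inner]
  have h1 := ((innerSL B F u).continuous.tendsto y).comp hTf
  have h2 := ((innerSL B E (S u)).continuous.tendsto x).comp hf
  rw [← innerSL_apply, ← innerSL_apply, h']
  refine tendsto_nhds_unique h1 (h2.congr fun n => ?_)
  exact (h' _).symm

/-- The algebra acts nondegenerately on the right of a Hilbert module. -/
theorem dense_span_rsmul :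
    Dense (Submodule.span ℂ (Set.range fun i : E × B => rsmul i.1 i.2) : Set E) := by
  let _ := CStarAlgebra.spectralOrder B
  have := CStarAlgebra.spectralOrderedRing B
  have h := CStarAlgebra.increasingApproximateUnit B
  have := h.toIsApproximateUnit.neBot
  intro x
  refine mem_closure_of_tendsto (b := CStarAlgebra.approximateUnit B) (f := fun e => rsmul x e) ?_
    (Filter.Eventually.of_forall fun e => Submodule.subset_span ⟨(x, e), rfl⟩)
  rw [tendsto_iff_norm_sub_tendsto_zero]
  -- With c = ⟪x, x⟫, the inner square of xe − x is e*(ce − c) − (ce − c), of norm at most 2‖ce − c‖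
  -- once ‖e‖ ≤ 1.
  have hsq : Filter.Tendsto (fun e : B => ‖rsmul x e - x‖ ^ 2) (CStarAlgebra.approximateUnit B)
      (nhds 0) := by
    set c : B := inner B x x
    have hval (e : B) : (inner B (rsmul x e - x) (rsmul x e - x) : B) =
        star e * (c * e - c) - (c * e - c) := by
      have h1 (y : E) : (inner B (rsmul x e - x) y : B) =
          star e * inner B x y - inner B x y := by
        rw [← inner_rsmul_left, ← star_inner, inner_sub_right, star_sub, star_inner, star_inner]
      rw [h1, inner_sub_right, inner_rsmul_right]
    have hc : Filter.Tendsto (fun e : B => c * e - c) (CStarAlgebra.approximateUnit B)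
        (nhds 0) := by
      simpa using (h.toIsApproximateUnit.tendsto_mul_left c).sub_const c
    refine squeeze_zero' (g := fun e => 2 * ‖c * e - c‖)
      (Filter.Eventually.of_forall fun e => by positivity) ?_ ?_
    · filter_upwards [h.eventually_norm] with e he
      rw [norm_sq_eq (B := B), hval]
      calc _ ≤ ‖star e‖ * ‖c * e - c‖ + ‖c * e - c‖ :=
            (norm_sub_le _ _).trans (by gcongr; exact norm_mul_le _ _)
        _ ≤ 1 * ‖c * e - c‖ + ‖c * e - c‖ := by rw [norm_star]; gcongr
        _ = _ := by ring
    · simpa using hc.norm.const_mul 2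
  simpa using hsq.sqrt

end HilbertModule

/-! ### 2-cells as bounded operators with adjoints. -/

section TwoCells

variable {A B : CStarAlg.{u}} {E F G : HilbertBimodule A B}

theorem hom_ext {S T : E ⟶ F} (h : ∀ x, app S x = app T x) : S = T :=
  BimoduleMap.ext (funext h)

@[simp]
theorem app_id (x : E) : app (𝟙 E) x = x := rfl

@[simp]
theorem app_comp (S : E ⟶ F) (T : F ⟶ G) (x : E) : app (S ≫ T) x = app T (app S x) := rfl

theorem app_leftAction (T : E ⟶ F) (a : A) (x : E) :
    app T (E.leftAction a x) = F.leftAction a (app T x) :=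
  BimoduleMap.map_leftAction T a x

/-- The adjoint of a 2-cell is a 2-cell. -/
theorem exists_adjoint (T : E ⟶ F) :
    ∃ S : F ⟶ E, ∀ x y, (inner B (app T x) y : B) = inner B x (app S y) := by
  obtain ⟨S, hS⟩ := BimoduleMap.adjointable T
  obtain ⟨S, rfl⟩ := HilbertModule.exists_linear_adjoint hS
  have hS' (x : E) (y : F) : (inner B (S y) x : B) = inner B y (app T x) := by
    rw [← HilbertModule.star_inner, ← hS, HilbertModule.star_inner]; rfl
  refine ⟨⟨S, fun a y => HilbertModule.ext_inner B fun u => ?_, app T, fun y x => hS' x y⟩, hS⟩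
  -- Left linearity of `S` is dual to that of `T`: ⟪u, S(ay)⟫ = ⟪a*Tu, y⟫ = ⟪T(a*u), y⟫ = ⟪u, aSy⟫.
  have h1 := E.inner_leftAction (star a) u (S y)
  have h2 := F.inner_leftAction (star a) (app T u) y
  rw [star_star] at h1 h2
  change inner B u (S (F.leftAction a y)) = inner B u (E.leftAction a (S y))
  rw [← h1, ← hS, ← hS]
  change inner B (app T u) _ = inner B (app T _) y
  rw [app_leftAction, h2]

/-- Besides being the first assertion of the theorem, this is the naturality of the right unitor. -/
theorem app_rsmul (T : E ⟶ F) (x : E) (b : B) :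
    app T (HilbertModule.rsmul x b) = HilbertModule.rsmul (app T x) b := by
  obtain ⟨S, hS⟩ := exists_adjoint T
  exact HilbertModule.map_rsmul_of_adjoint hS x b

/-- A 2-cell as a bounded operator. -/
noncomputable def appL (T : E ⟶ F) : E →L[ℂ] F where
  toLinearMap := BimoduleMap.toLinearMap T
  cont := by
    obtain ⟨S, hS⟩ := exists_adjoint T
    exact HilbertModule.continuous_of_adjoint (T := BimoduleMap.toLinearMap T) hS

/-- The left action of a fixed element as a bounded operator. -/
noncomputable def leftActionL (E : HilbertBimodule A B) (a : A) : E →L[ℂ] E :=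
  (E.leftAction a).mkContinuous ‖a‖ fun x => E.norm_leftAction_le a x

@[simp]
theorem leftActionL_apply (E : HilbertBimodule A B) (a : A) (x : E) :
    leftActionL E a x = E.leftAction a x := rfl

/-- Since 2-cells are bounded, a total family detects equality; every coherence axiom is reduced to
generators through this lemma. -/
theorem hom_ext_of_dense {I : Type*} {p : I → E}
    (hp : Dense (Submodule.span ℂ (Set.range p) : Set E)) {S T : E ⟶ F}
    (h : ∀ i, app S (p i) = app T (p i)) : S = T := by
  have : appL S = appL T := ContinuousLinearMap.ext_on hp (by rintro _ ⟨i, rfl⟩; exact h i)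
  exact hom_ext fun x => congrArg (fun f => f x) this

end TwoCells

/-! ### Extending maps of total families to 2-cells. -/

section Extension

variable {A B : CStarAlg.{u}} {E F : HilbertBimodule A B} {I J : Type*} {p : I → E} {q : J → F}
  {τ : I → J} {σ : J → I}

/-- Sesquilinearity carries adjointness from generators to formal combinations. Working in `I →₀ ℂ`
postpones the question whether p i ↦ q (τ i) respects linear relations in `E`. -/
theorem inner_linearCombination_mapDomain
    (hadj : ∀ i j, (inner B (q (τ i)) (q j) : B) = inner B (p i) (p (σ j)))
    (v : I →₀ ℂ) (w : J →₀ ℂ) :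
    (inner B (Finsupp.linearCombination ℂ q (v.mapDomain τ)) (Finsupp.linearCombination ℂ q w) : B)
      = inner B (Finsupp.linearCombination ℂ p v)
        (Finsupp.linearCombination ℂ p (w.mapDomain σ)) := by
  simp only [← HilbertModule.innerSL_apply]
  induction v using Finsupp.induction_linear with
  | zero => simp
  | add v v' h h' =>
    simp only [Finsupp.mapDomain_add, map_add, add_apply, h, h']
  | single i c =>
    induction w using Finsupp.induction_linear with
    | zero => simp
    | add w w' h h' => simp only [Finsupp.mapDomain_add, map_add, h, h']
    | single j d =>
      simp only [Finsupp.mapDomain_single, Finsupp.linearCombination_single, map_smulₛₗ,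
        smul_apply, HilbertModule.innerSL_apply, hadj]

/-- A densely defined adjointable map is bounded if the iterates of its product with its adjoint
grow at most geometrically. -/
theorem exists_bound_linearCombination
    (hadj : ∀ i j, (inner B (q (τ i)) (q j) : B) = inner B (p i) (p (σ j)))
    {M : ℝ} (hM : 0 < M) (hgrowth : ∀ i, ∃ K, ∀ n, ‖p ((σ ∘ τ)^[n] i)‖ ≤ K * M ^ n) :
    ∃ C, 0 ≤ C ∧ ∀ v : I →₀ ℂ, ‖Finsupp.linearCombination ℂ q (v.mapDomain τ)‖ ≤
      C * ‖Finsupp.linearCombination ℂ p v‖ := by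
  set P : (I →₀ ℂ) →ₗ[ℂ] E := Finsupp.linearCombination ℂ p with hP
  set Q : (J →₀ ℂ) →ₗ[ℂ] F := Finsupp.linearCombination ℂ q
  -- `R n` is the n-th power of the would-be T*T, on formal combinations.
  let R (n : ℕ) (v : I →₀ ℂ) : I →₀ ℂ := v.mapDomain ((σ ∘ τ)^[n])
  have hR (n m : ℕ) (v : I →₀ ℂ) : R n (R m v) = R (n + m) v := by
    simp only [R, Function.iterate_add, Finsupp.mapDomain_comp]
  have hQ (v : I →₀ ℂ) : (inner B (Q (v.mapDomain τ)) (Q (v.mapDomain τ)) : B) =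
      inner B (P v) (P (R 1 v)) := by
    rw [inner_linearCombination_mapDomain hadj, ← Finsupp.mapDomain_comp]; rfl
  have hsymm1 (v w : I →₀ ℂ) : (inner B (P (R 1 v)) (P w) : B) = inner B (P v) (P (R 1 w)) := by
    have h (v w : I →₀ ℂ) : (inner B (Q (v.mapDomain τ)) (Q (w.mapDomain τ)) : B) =
        inner B (P v) (P (R 1 w)) := by
      rw [inner_linearCombination_mapDomain hadj, ← Finsupp.mapDomain_comp]; rfl
    rw [← h, ← HilbertModule.star_inner, ← h, HilbertModule.star_inner]
  have hsymm (n : ℕ) (v w : I →₀ ℂ) :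
      (inner B (P (R n v)) (P w) : B) = inner B (P v) (P (R n w)) := by
    induction n generalizing v w with
    | zero => simp [R]
    | succ n ih => rw [← hR, ih, hsymm1, hR, add_comm]
  -- `K` depends on how `v` is written as a combination, with no control by ‖P v‖; the log-convexity
  -- estimate discards it.
  have hgrow (v : I →₀ ℂ) : ∃ K, ∀ n, ‖P (R n v)‖ ≤ K * M ^ n := by
    induction v using Finsupp.induction_linear with
    | zero => exact ⟨0, fun n => by simp [R]⟩
    | add v v' h h' =>
      obtain ⟨K, hK⟩ := h
      obtain ⟨K', hK'⟩ := h'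
      refine ⟨K + K', fun n => ?_⟩
      simp only [R, Finsupp.mapDomain_add, map_add, add_mul]
      exact (norm_add_le _ _).trans (add_le_add (hK n) (hK' n))
    | single i c =>
      obtain ⟨K, hK⟩ := hgrowth i
      refine ⟨‖c‖ * K, fun n => ?_⟩
      simp only [R, Finsupp.mapDomain_single, hP, Finsupp.linearCombination_single, norm_smul,
        mul_assoc]
      exact mul_le_mul_of_nonneg_left (hK n) (norm_nonneg c)
  have hR0 (v : I →₀ ℂ) : R 0 v = v := by simp [R]
  -- `M` bounds T*T, so its square root bounds T.
  refine ⟨√M, M.sqrt_nonneg, fun v => ?_⟩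
  have h1 : ‖P (R 1 v)‖ ≤ M * ‖P (R 0 v)‖ := by
    refine le_mul_of_sq_le_of_growth (a := fun n => ‖P (R n v)‖) (norm_nonneg _) (fun n => ?_) hM
      (hgrow v)
    rw [HilbertModule.norm_sq_eq (B := B), hsymm, hR, hR0, two_mul]
    exact HilbertModule.norm_inner_le _ _
  rw [hR0] at h1
  refine abs_le_of_sq_le_sq' ?_ (by positivity) |>.2
  rw [HilbertModule.norm_sq_eq (B := B), hQ, mul_pow, Real.sq_sqrt hM.le]
  calc _ ≤ ‖P v‖ * ‖P (R 1 v)‖ := HilbertModule.norm_inner_le _ _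
    _ ≤ ‖P v‖ * (M * ‖P v‖) := by gcongr
    _ = _ := by ring

theorem denseRange_linearCombination
    (hp : Dense (Submodule.span ℂ (Set.range p) : Set E)) :
    DenseRange (Finsupp.linearCombination ℂ p) := by
  rwa [← Finsupp.range_linearCombination, LinearMap.coe_range] at hp

/-- A map between total families of vectors which has an adjoint with respect to the inner
products, whose iterates grow at most geometrically, and which is compatible with the left
actions extends to a 2-cell. -/
theorem exists_hom (hp : Dense (Submodule.span ℂ (Set.range p) : Set E))
    (hq : Dense (Submodule.span ℂ (Set.range q) : Set F))
    (hadj : ∀ i j, (inner B (q (τ i)) (q j) : B) = inner B (p i) (p (σ j)))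
    {M : ℝ} (hM : 0 < M) (hgrowth : ∀ i, ∃ K, ∀ n, ‖p ((σ ∘ τ)^[n] i)‖ ≤ K * M ^ n)
    (hact : ∀ a i, ∃ i', E.leftAction a (p i) = p i' ∧ F.leftAction a (q (τ i)) = q (τ i')) :
    ∃ T : E ⟶ F, ∀ i, app T (p i) = q (τ i) := by
  have := HilbertModule.complete B (E := E)
  have := HilbertModule.complete B (E := F)
  have hP := denseRange_linearCombination hp
  have hQ := denseRange_linearCombination hq
  set P : (I →₀ ℂ) →ₗ[ℂ] E := Finsupp.linearCombination ℂ p with hPdef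
  set Q : (J →₀ ℂ) →ₗ[ℂ] F := Finsupp.linearCombination ℂ q with hQdef
  obtain ⟨c, hc0, hc⟩ := exists_bound_linearCombination hadj hM hgrowth
  have hinner := inner_linearCombination_mapDomain hadj
  -- The adjoint inherits the same bound: ‖Sw‖² = ‖⟪TSw, w⟫‖ ≤ c‖Sw‖‖w‖. Growth is therefore assumed
  -- on one side only.
  have hd (w : J →₀ ℂ) : ‖P (w.mapDomain σ)‖ ≤ c * ‖Q w‖ := by
    rcases (norm_nonneg (P (w.mapDomain σ))).eq_or_lt with h | h
    · rw [← h]; positivity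
    refine le_of_mul_le_mul_left ?_ h
    rw [← sq, HilbertModule.norm_sq_eq (B := B), ← hinner]
    calc _ ≤ _ := HilbertModule.norm_inner_le _ _
      _ ≤ c * ‖P (w.mapDomain σ)‖ * ‖Q w‖ := by gcongr; exact hc _
      _ = _ := by ring
  -- The norm bound makes the map factor through the dense range of `P`, and it then extends by
  -- completeness of `F`.
  let T : E →L[ℂ] F := (Q ∘ₗ Finsupp.lmapDomain ℂ ℂ τ).extendOfNorm P
  let S : F →L[ℂ] E := (P ∘ₗ Finsupp.lmapDomain ℂ ℂ σ).extendOfNorm Q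
  have hT (v : I →₀ ℂ) : T (P v) = Q (v.mapDomain τ) :=
    LinearMap.extendOfNorm_eq hP ⟨c, hc⟩ v
  have hS (w : J →₀ ℂ) : S (Q w) = P (w.mapDomain σ) :=
    LinearMap.extendOfNorm_eq hQ ⟨c, hd⟩ w
  have hTp (i : I) : T (p i) = q (τ i) := by
    simpa [hPdef, hQdef, Finsupp.mapDomain_single] using hT (Finsupp.single i 1)
  have hTS (x : E) (y : F) : HilbertModule.innerSL B F (T x) y =
      HilbertModule.innerSL B E x (S y) := by
    induction x using hP.induction_on with
    | hp => exact isClosed_eq (by fun_prop) (by fun_prop)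
    | ih v =>
      induction y using hQ.induction_on with
      | hp => exact isClosed_eq (by fun_prop) (by fun_prop)
      | ih w => rw [hT, hS]; exact hinner v w
  have hTact (a : A) : T ∘L leftActionL E a = leftActionL F a ∘L T := by
    refine ContinuousLinearMap.ext_on hp ?_
    rintro _ ⟨i, rfl⟩
    obtain ⟨i', h1, h2⟩ := hact a i
    simp only [ContinuousLinearMap.comp_apply, leftActionL_apply, hTp, h1, h2]
  exact ⟨⟨T.toLinearMap, fun a x => congrArg (fun f => f x) (hTact a), S, hTS⟩, hTp⟩

/-- Total families of vectors with the same inner products and compatible left actions are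
identified by an invertible 2-cell. -/
theorem exists_iso {q : I → F} (hp : Dense (Submodule.span ℂ (Set.range p) : Set E))
    (hq : Dense (Submodule.span ℂ (Set.range q) : Set F))
    (hinner : ∀ i j, (inner B (q i) (q j) : B) = inner B (p i) (p j))
    (hact : ∀ a i, ∃ i', E.leftAction a (p i) = p i' ∧ F.leftAction a (q i) = q i') :
    ∃ T : E ≅ F, ∀ i, app T.hom (p i) = q i := by
  -- The iterates of the identity are constant, so M = 1 and K = ‖p i‖ serve.
  obtain ⟨T, hT⟩ := exists_hom (τ := id) (σ := id) hp hq hinner one_pos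
    (fun i => ⟨‖p i‖, fun n => by simp⟩) hact
  obtain ⟨S, hS⟩ := exists_hom (τ := id) (σ := id) hq hp (fun i j => (hinner i j).symm) one_pos
    (fun i => ⟨‖q i‖, fun n => by simp⟩) (fun a i => (hact a i).imp fun _ h => ⟨h.2, h.1⟩)
  simp only [id] at hT hS
  exact ⟨⟨T, S, hom_ext_of_dense hp fun i => by rw [app_comp, hT, hS, app_id],
    hom_ext_of_dense hq fun i => by rw [app_comp, hS, hT, app_id]⟩, hT⟩

end Extension

/-! ### Elementary tensors and their totality. -/

namespace HilbertBimodule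

variable {A B C D : CStarAlg.{u}} {E E' : HilbertBimodule A B} {F F' : HilbertBimodule B C}
  {G : HilbertBimodule C D}

theorem inner_tmul (x x' : E) (y y' : F) :
    (inner C (tmul x y) (tmul x' y') : C) = inner C y (F.leftAction (inner B x x') y') :=
  ((tensorSemiInner E F).innerL_ι _ _).trans (tensorForm_tmul E F x x' y y')

theorem leftAction_tmul (a : A) (x : E) (y : F) :
    (E.tensor F).leftAction a (tmul x y) = tmul (E.leftAction a x) y :=
  (tensorSemiInner E F).extendRep_ι (tensorRep E F) (tensorForm_tensorRep E F) a (x ⊗ₜ y)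

theorem norm_tmul_le (x : E) (y : F) : ‖tmul x y‖ ≤ ‖x‖ * ‖y‖ := by
  rw [mul_comm]; exact norm_ι_tmul_le E F x y

variable (E F) in
/-- The canonical map from the algebraic to the interior tensor product. -/
noncomputable def tensorι : E ⊗[ℂ] F →ₗ[ℂ] E.tensor F := (tensorSemiInner E F).ι

variable (E F) in
/-- The elementary tensors as a bounded bilinear map. -/
noncomputable def tmulL : E →L[ℂ] F →L[ℂ] E.tensor F :=
  ((TensorProduct.mk ℂ E F).compr₂ (tensorι E F)).mkContinuous₂ 1 fun x y => by
    rw [one_mul]; exact norm_tmul_le x y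

variable (E F) in
theorem dense_span_tmul :
    Dense (Submodule.span ℂ (Set.range fun i : E × F => tmul i.1 i.2) : Set (E.tensor F)) := by
  set W := Submodule.span ℂ (Set.range fun i : E × F => (tmul i.1 i.2 : E.tensor F))
  have h : (⊤ : Submodule ℂ (E ⊗[ℂ] F)) ≤ W.comap (tensorι E F) := by
    rw [← TensorProduct.span_tmul_eq_top, Submodule.span_le]
    rintro _ ⟨x, y, rfl⟩
    exact Submodule.subset_span ⟨(x, y), rfl⟩
  refine Dense.mono ?_ (tensorSemiInner E F).denseRange_ι
  rintro _ ⟨t, rfl⟩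
  exact h (Submodule.mem_top (x := t))

/-- x ⊗ y is bounded in each variable, so y is approximated first with a generator `p i` fixed, then
x. This yields total families in iterated tensor products. -/
theorem dense_span_tmul_of_dense {I J : Type*} {p : I → E} {q : J → F}
    (hp : Dense (Submodule.span ℂ (Set.range p) : Set E))
    (hq : Dense (Submodule.span ℂ (Set.range q) : Set F)) :
    Dense (Submodule.span ℂ (Set.range fun i : I × J => tmul (p i.1) (q i.2)) :
      Set (E.tensor F)) := by
  set W := Submodule.span ℂ (Set.range fun i : I × J => tmul (p i.1) (q i.2))
  have h1 (i : I) (y : F) : tmul (p i) y ∈ W.topologicalClosure := by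
    refine map_mem_closure (f := tmulL E F (p i)) (tmulL E F (p i)).continuous (hq y) fun z hz => ?_
    suffices h : Submodule.span ℂ (Set.range q) ≤ W.comap (tmulL E F (p i)).toLinearMap from h hz
    rw [Submodule.span_le]
    rintro _ ⟨j, rfl⟩
    exact Submodule.subset_span ⟨(i, j), rfl⟩
  have h2 (x : E) (y : F) : tmul x y ∈ W.topologicalClosure := by
    -- The vectors p i ⊗ y are known only to lie in the closure of `W`, so the second approximation
    -- takes place in the closure of that closure.
    rw [← W.isClosed_topologicalClosure.submodule_topologicalClosure_eq]
    refine map_mem_closure (f := (tmulL E F).flip y) ((tmulL E F).flip y).continuous (hp x)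
      fun z hz => ?_
    suffices h : Submodule.span ℂ (Set.range p) ≤
      W.topologicalClosure.comap ((tmulL E F).flip y).toLinearMap from h hz
    rw [Submodule.span_le]
    rintro _ ⟨i, rfl⟩
    exact h1 i y
  have h3 : Dense (W.topologicalClosure : Set (E.tensor F)) :=
    (dense_span_tmul E F).mono (Submodule.span_le.mpr (by rintro _ ⟨i, rfl⟩; exact h2 _ _))
  rw [Submodule.topologicalClosure_coe] at h3
  exact dense_closure.mp h3

theorem dense_span_range_id (E : HilbertBimodule A B) :
    Dense (Submodule.span ℂ (Set.range fun x : E => x) : Set E) :=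
  fun x => subset_closure (Submodule.subset_span ⟨x, rfl⟩)

/-- 2-cells which agree on elementary tensors are equal. -/
theorem tensor_hom_ext {X : HilbertBimodule A C} {S T : E.tensor F ⟶ X}
    (h : ∀ (x : E) (y : F), app S (tmul x y) = app T (tmul x y)) : S = T :=
  hom_ext_of_dense (dense_span_tmul E F) fun i => h i.1 i.2

end HilbertBimodule

namespace HilbertBimodule

variable {A B C D : CStarAlg.{u}}

/-! ### Equality of 2-cells on iterated tensor products, and the balancing relation. -/

section Extensionality

variable {E : HilbertBimodule A B} {F : HilbertBimodule B C} {G : HilbertBimodule C D}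
  {D' : CStarAlg.{u}} {H : HilbertBimodule D D'}

theorem dense_span_tmul_tmul (E : HilbertBimodule A B) (F : HilbertBimodule B C)
    (G : HilbertBimodule C D) :
    Dense (Submodule.span ℂ (Set.range fun i : (E × F) × G => tmul (tmul i.1.1 i.1.2) i.2) :
      Set ((E.tensor F).tensor G)) :=
  dense_span_tmul_of_dense (p := fun i : E × F => tmul i.1 i.2) (q := fun z : G => z)
    (dense_span_tmul E F) (dense_span_range_id G)

/-- The triples are bracketed as `(E × F) × G` here too, so that both tensor products have total
families over one index type, as `exists_iso` requires. -/
theorem dense_span_tmul_tmul' (E : HilbertBimodule A B) (F : HilbertBimodule B C)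
    (G : HilbertBimodule C D) :
    Dense (Submodule.span ℂ (Set.range fun i : (E × F) × G => tmul i.1.1 (tmul i.1.2 i.2)) :
      Set (E.tensor (F.tensor G))) := by
  refine (dense_span_tmul_of_dense (dense_span_range_id E) (dense_span_tmul F G)).mono
    (Submodule.span_mono ?_)
  rintro _ ⟨⟨x, y, z⟩, rfl⟩
  exact ⟨((x, y), z), rfl⟩

theorem tensor_tensor_hom_ext {X : HilbertBimodule A D} {S T : (E.tensor F).tensor G ⟶ X}
    (h : ∀ (x : E) (y : F) (z : G),
      app S (tmul (tmul x y) z) = app T (tmul (tmul x y) z)) : S = T :=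
  hom_ext_of_dense (dense_span_tmul_tmul E F G) fun i => h i.1.1 i.1.2 i.2

theorem tensor_tensor_hom_ext' {X : HilbertBimodule A D} {S T : E.tensor (F.tensor G) ⟶ X}
    (h : ∀ (x : E) (y : F) (z : G),
      app S (tmul x (tmul y z)) = app T (tmul x (tmul y z))) : S = T :=
  hom_ext_of_dense (dense_span_tmul_tmul' E F G) fun i => h i.1.1 i.1.2 i.2

theorem tensor_tensor_tensor_hom_ext {X : HilbertBimodule A D'}
    {S T : ((E.tensor F).tensor G).tensor H ⟶ X}
    (h : ∀ (x : E) (y : F) (z : G) (t : H),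
      app S (tmul (tmul (tmul x y) z) t) = app T (tmul (tmul (tmul x y) z) t)) : S = T :=
  hom_ext_of_dense
    (dense_span_tmul_of_dense (p := fun i : (E × F) × G => tmul (tmul i.1.1 i.1.2) i.2)
      (q := fun t : H => t) (dense_span_tmul_tmul E F G) (dense_span_range_id H))
    fun i => h i.1.1.1 i.1.1.2 i.1.2 i.2

/-- The interior tensor product is balanced. -/
theorem rsmul_tmul_eq (x : E) (b : B) (y : F) :
    tmul (HilbertModule.rsmul x b) y = tmul x (F.leftAction b y) := by
  refine HilbertModule.ext_inner C fun u => ?_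
  -- It suffices to pair with elementary tensors x' ⊗ y', where both sides give ⟪y', ⟪x', x⟫by⟫.
  have h : (HilbertModule.innerSL C (E.tensor F)).flip (tmul (HilbertModule.rsmul x b) y) =
      (HilbertModule.innerSL C (E.tensor F)).flip (tmul x (F.leftAction b y)) := by
    refine ContinuousLinearMap.ext_on (dense_span_tmul E F) ?_
    rintro _ ⟨i, rfl⟩
    simp only [ContinuousLinearMap.flip_apply, HilbertModule.innerSL_apply, inner_tmul,
      HilbertModule.inner_rsmul_right, map_mul, Module.End.mul_apply]
  exact congrArg (fun f => f u) h

end Extensionality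

/-! ### Whiskerings, associators and unitors. -/

section Structure

/-- The summand 1 keeps the rate positive when T = 0, as `exists_hom` needs M > 0. -/
theorem norm_iterate_le {E : HilbertBimodule A B} (T : E →L[ℂ] E) (x : E) (n : ℕ) :
    ‖T^[n] x‖ ≤ ‖x‖ * (‖T‖ + 1) ^ n := by
  induction n with
  | zero => simp
  | succ n ih =>
    rw [Function.iterate_succ_apply', pow_succ, ← mul_assoc, mul_comm _ (‖T‖ + 1)]
    exact (T.le_opNorm _).trans (mul_le_mul (le_add_of_nonneg_right zero_le_one) ih
      (norm_nonneg _) (by positivity))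

/-- The adjoint is x ⊗ y ↦ x ⊗ Sy, because `S` commutes with the left action of ⟪x, x'⟫; this is
where the adjoint has to be a 2-cell itself. -/
theorem exists_whiskerLeft (E : HilbertBimodule A B) {F F' : HilbertBimodule B C} (T : F ⟶ F') :
    ∃ W : E.tensor F ⟶ E.tensor F', ∀ i : E × F, app W (tmul i.1 i.2) = tmul i.1 (app T i.2) := by
  obtain ⟨S, hS⟩ := exists_adjoint T
  refine exists_hom (p := fun i : E × F => tmul i.1 i.2) (q := fun i : E × F' => tmul i.1 i.2)
    (τ := Prod.map id (app T)) (σ := Prod.map id (app S)) (dense_span_tmul E F)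
    (dense_span_tmul E F') (fun i j => ?_) (M := ‖appL S ∘L appL T‖ + 1) (by positivity)
    (fun i => ⟨‖i.1‖ * ‖i.2‖, fun n => ?_⟩) fun a i => ⟨(E.leftAction a i.1, i.2), ?_, ?_⟩
  · simp only [inner_tmul, Prod.map_fst, Prod.map_snd, hS, id, app_leftAction]
  · rw [Prod.map_comp_map, Prod.map_iterate, mul_assoc]
    refine (norm_tmul_le _ _).trans ?_
    simp only [Prod.map_fst, Prod.map_snd, Function.id_comp, Function.iterate_id, id]
    gcongr
    exact norm_iterate_le (appL S ∘L appL T) i.2 n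
  · exact leftAction_tmul _ _ _
  · exact leftAction_tmul _ _ _

/-- Adjointness is immediate from ⟪Tx, x'⟫ = ⟪x, Sx'⟫ in `B`; left linearity of `T` is used only for
compatibility with `A`. -/
theorem exists_whiskerRight {E E' : HilbertBimodule A B} (T : E ⟶ E') (F : HilbertBimodule B C) :
    ∃ W : E.tensor F ⟶ E'.tensor F, ∀ i : E × F, app W (tmul i.1 i.2) = tmul (app T i.1) i.2 := by
  obtain ⟨S, hS⟩ := exists_adjoint T
  refine exists_hom (p := fun i : E × F => tmul i.1 i.2) (q := fun i : E' × F => tmul i.1 i.2)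
    (τ := Prod.map (app T) id) (σ := Prod.map (app S) id) (dense_span_tmul E F)
    (dense_span_tmul E' F) (fun i j => ?_) (M := ‖appL S ∘L appL T‖ + 1) (by positivity)
    (fun i => ⟨‖i.1‖ * ‖i.2‖, fun n => ?_⟩) fun a i => ⟨(E.leftAction a i.1, i.2), ?_, ?_⟩
  · simp only [inner_tmul, Prod.map_fst, Prod.map_snd, hS, id]
  · rw [Prod.map_comp_map, Prod.map_iterate, mul_right_comm]
    refine (norm_tmul_le _ _).trans ?_
    simp only [Prod.map_fst, Prod.map_snd, Function.id_comp, Function.iterate_id, id]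
    gcongr
    exact norm_iterate_le (appL S ∘L appL T) i.1 n
  · exact leftAction_tmul _ _ _
  · simp only [leftAction_tmul, Prod.map_fst, Prod.map_snd, id, app_leftAction]

/-- For both bracketings the inner product of two triples is ⟪z, ⟪y, ⟪x, x'⟫y'⟫z'⟫. -/
theorem exists_associator (E : HilbertBimodule A B) (F : HilbertBimodule B C)
    (G : HilbertBimodule C D) :
    ∃ T : (E.tensor F).tensor G ≅ E.tensor (F.tensor G), ∀ i : (E × F) × G,
      app T.hom (tmul (tmul i.1.1 i.1.2) i.2) = tmul i.1.1 (tmul i.1.2 i.2) :=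
  exists_iso (dense_span_tmul_tmul E F G) (dense_span_tmul_tmul' E F G)
    (fun i j => by simp only [inner_tmul, leftAction_tmul])
    fun a i => ⟨((E.leftAction a i.1.1, i.1.2), i.2), by simp only [leftAction_tmul],
      by simp only [leftAction_tmul]⟩

/-- Isometry is ⟪ax, a'x'⟫ = ⟪x, a*a'x'⟫, and nondegeneracy of `E` is exactly density of the range.
-/
theorem exists_leftUnitor (E : HilbertBimodule A B) :
    ∃ T : (unitBimodule A).tensor E ≅ E, ∀ i : A × E,
      app T.hom (tmul (E := unitBimodule A) i.1 i.2) = E.leftAction i.1 i.2 := by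
  refine exists_iso (p := fun i : A × E => tmul (E := unitBimodule A) i.1 i.2)
    (q := fun i : A × E => E.leftAction i.1 i.2) (dense_span_tmul (unitBimodule A) E)
    (E.nondegenerate.mono (Submodule.span_mono ?_))
    (fun i j => ((inner_tmul (E := unitBimodule A) _ _ _ _).trans
      (E.inner_leftAction_mul i.1 j.1 i.2 j.2)).symm)
    fun a i => ⟨(a * i.1, i.2), leftAction_tmul (E := unitBimodule A) a i.1 i.2,
      (congrArg (fun f => f i.2) (map_mul E.leftAction a i.1)).symm⟩
  rintro _ ⟨a, x, rfl⟩
  exact ⟨(a, x), rfl⟩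

/-- Isometry is ⟪xb, x'b'⟫ = b*⟪x, x'⟫b'; density needs no hypothesis on `E`. -/
theorem exists_rightUnitor (E : HilbertBimodule A B) :
    ∃ T : E.tensor (unitBimodule B) ≅ E, ∀ i : E × B,
      app T.hom (tmul (F := unitBimodule B) i.1 i.2) = HilbertModule.rsmul i.1 i.2 := by
  refine exists_iso (p := fun i : E × B => tmul (F := unitBimodule B) i.1 i.2)
    (q := fun i : E × B => HilbertModule.rsmul i.1 i.2) (dense_span_tmul E (unitBimodule B))
    HilbertModule.dense_span_rsmul (fun i j => ?_)
    fun a i => ⟨(E.leftAction a i.1, i.2), leftAction_tmul (F := unitBimodule B) a i.1 i.2,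
      leftAction_rsmul E a i.1 i.2⟩
  refine Eq.trans ?_ (inner_tmul (F := unitBimodule B) _ _ _ _).symm
  rw [HilbertModule.inner_rsmul_right, HilbertModule.inner_rsmul_left, mul_assoc]
  rfl

/-- Left whiskering `x ⊗ y ↦ x ⊗ T y`. -/
noncomputable def whiskerLeft (E : HilbertBimodule A B) {F F' : HilbertBimodule B C}
    (T : F ⟶ F') : E.tensor F ⟶ E.tensor F' :=
  (exists_whiskerLeft E T).choose

/-- Right whiskering `x ⊗ y ↦ T x ⊗ y`. -/
noncomputable def whiskerRight {E E' : HilbertBimodule A B} (T : E ⟶ E')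
    (F : HilbertBimodule B C) : E.tensor F ⟶ E'.tensor F :=
  (exists_whiskerRight T F).choose

/-- The associator `(x ⊗ y) ⊗ z ↦ x ⊗ (y ⊗ z)`. -/
noncomputable def associator (E : HilbertBimodule A B) (F : HilbertBimodule B C)
    (G : HilbertBimodule C D) : (E.tensor F).tensor G ≅ E.tensor (F.tensor G) :=
  (exists_associator E F G).choose

/-- The left unitor `a ⊗ x ↦ a x`. -/
noncomputable def leftUnitor (E : HilbertBimodule A B) : (unitBimodule A).tensor E ≅ E :=
  (exists_leftUnitor E).choose

/-- The right unitor `x ⊗ b ↦ x b`. -/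
noncomputable def rightUnitor (E : HilbertBimodule A B) : E.tensor (unitBimodule B) ≅ E :=
  (exists_rightUnitor E).choose

@[simp]
theorem whiskerLeft_tmul (E : HilbertBimodule A B) {F F' : HilbertBimodule B C} (T : F ⟶ F')
    (x : E) (y : F) : app (whiskerLeft E T) (tmul x y) = tmul x (app T y) :=
  (exists_whiskerLeft E T).choose_spec (x, y)

@[simp]
theorem whiskerRight_tmul {E E' : HilbertBimodule A B} (T : E ⟶ E') (F : HilbertBimodule B C)
    (x : E) (y : F) : app (whiskerRight T F) (tmul x y) = tmul (app T x) y :=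
  (exists_whiskerRight T F).choose_spec (x, y)

@[simp]
theorem associator_hom_tmul (E : HilbertBimodule A B) (F : HilbertBimodule B C)
    (G : HilbertBimodule C D) (x : E) (y : F) (z : G) :
    app (associator E F G).hom (tmul (tmul x y) z) = tmul x (tmul y z) :=
  (exists_associator E F G).choose_spec ((x, y), z)

@[simp]
theorem associator_inv_tmul (E : HilbertBimodule A B) (F : HilbertBimodule B C)
    (G : HilbertBimodule C D) (x : E) (y : F) (z : G) :
    app (associator E F G).inv (tmul x (tmul y z)) = tmul (tmul x y) z := by
  rw [← associator_hom_tmul, ← app_comp, Iso.hom_inv_id, app_id]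

@[simp]
theorem leftUnitor_hom_tmul (E : HilbertBimodule A B) (a : A) (x : E) :
    app (leftUnitor E).hom (tmul (E := unitBimodule A) a x) = E.leftAction a x :=
  (exists_leftUnitor E).choose_spec (a, x)

@[simp]
theorem rightUnitor_hom_tmul (E : HilbertBimodule A B) (x : E) (b : B) :
    app (rightUnitor E).hom (tmul (F := unitBimodule B) x b) = HilbertModule.rsmul x b :=
  (exists_rightUnitor E).choose_spec (x, b)

end Structure

end HilbertBimodule

/-! ### The bicategory axioms, checked on elementary tensors. -/

open HilbertBimodule in
/-- The bicategory of C*-algebras, Hilbert bimodules and adjointable maps. -/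
noncomputable abbrev cstarBicategory : Bicategory CStarAlg.{u} where
  Hom := HilbertBimodule
  id := unitBimodule
  comp := tensor
  homCategory := homCategory
  whiskerLeft := whiskerLeft
  whiskerRight := whiskerRight
  associator := associator
  leftUnitor := leftUnitor
  rightUnitor := rightUnitor
  whiskerLeft_id E F := tensor_hom_ext fun x y => by
    rw [whiskerLeft_tmul, app_id, app_id]
  whiskerLeft_comp E F G H S T := tensor_hom_ext fun x y => by
    simp only [whiskerLeft_tmul, app_comp]
  id_whiskerLeft {A B E F} T := by
    -- The inverse unitor has no formula on a general vector, so it is moved across; what remains is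
    -- T(ax) = aT(x).
    rw [← Category.assoc, Iso.eq_comp_inv]
    exact tensor_hom_ext fun a x => by
      rw [app_comp, app_comp, whiskerLeft_tmul]
      exact (leftUnitor_hom_tmul F a (app T x)).trans ((app_leftAction T a x).symm.trans
        (congrArg (app T) (leftUnitor_hom_tmul E a x).symm))
  comp_whiskerLeft E F G H T := tensor_tensor_hom_ext fun x y z => by
    simp only [app_comp, whiskerLeft_tmul, associator_hom_tmul, associator_inv_tmul]
  id_whiskerRight E F := tensor_hom_ext fun x y => by
    rw [whiskerRight_tmul, app_id, app_id]
  comp_whiskerRight S T F := tensor_hom_ext fun x y => by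
    simp only [whiskerRight_tmul, app_comp]
  whiskerRight_id {A B E F} T := by
    rw [← Category.assoc, Iso.eq_comp_inv]
    exact tensor_hom_ext fun x b => by
      rw [app_comp, app_comp, whiskerRight_tmul]
      exact (rightUnitor_hom_tmul F (app T x) b).trans ((app_rsmul T x b).symm.trans
        (congrArg (app T) (rightUnitor_hom_tmul E x b).symm))
  whiskerRight_comp T F G := tensor_tensor_hom_ext' fun x y z => by
    simp only [app_comp, whiskerRight_tmul, associator_hom_tmul, associator_inv_tmul]
  whisker_assoc E F F' T G := tensor_tensor_hom_ext fun x y z => by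
    simp only [app_comp, whiskerLeft_tmul, whiskerRight_tmul, associator_hom_tmul,
      associator_inv_tmul]
  whisker_exchange S T := tensor_hom_ext fun x y => by
    simp only [app_comp, whiskerLeft_tmul, whiskerRight_tmul]
  pentagon E F G H := tensor_tensor_tensor_hom_ext fun x y z t => by
    simp only [app_comp, whiskerLeft_tmul, whiskerRight_tmul, associator_hom_tmul]
  -- On (x ⊗ b) ⊗ y the triangle reads x ⊗ by = xb ⊗ y.
  triangle E F := tensor_tensor_hom_ext fun x b y => by
    rw [app_comp, associator_hom_tmul, whiskerLeft_tmul, whiskerRight_tmul]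
    exact (congrArg (tmul x) (leftUnitor_hom_tmul F b y)).trans ((rsmul_tmul_eq x b y).symm.trans
      (congrArg (tmul · y) (rightUnitor_hom_tmul E x b).symm))

end CStarBicat

/-- C*-algebras, Hilbert bimodules and adjointable maps form a bicategory: adjointable left-linear
maps are bimodule maps, and there is a bicategory whose objects are the C*-algebras, whose 1-cells
between `A` and `B` are the `A`-`B` Hilbert bimodules, with the adjointable `A`-linear maps as
2-cells, whose composition is the interior tensor product (acting on 2-cells by
`x ⊗ y ↦ x ⊗ T y` and `x ⊗ y ↦ T x ⊗ y`), whose units are the canonical bimodules, and whose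
associators and unitors are the canonical ones. -/
theorem theorem4p3 :
    (∀ (A B : CStarAlg.{u}) (E F : HilbertBimodule A B) (T : E ⟶ F) (x : E) (b : B),
      app T (HilbertModule.rsmul x b) = HilbertModule.rsmul (app T x) b) ∧
    ∃ (wl : ∀ {A B C : CStarAlg.{u}} (E : HilbertBimodule A B) {F F' : HilbertBimodule B C},
        (F ⟶ F') → (E.tensor F ⟶ E.tensor F'))
      (wr : ∀ {A B C : CStarAlg.{u}} {E E' : HilbertBimodule A B},
        (E ⟶ E') → ∀ F : HilbertBimodule B C, (E.tensor F ⟶ E'.tensor F))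
      (α : ∀ {A B C D : CStarAlg.{u}} (E : HilbertBimodule A B) (F : HilbertBimodule B C)
        (G : HilbertBimodule C D), (E.tensor F).tensor G ≅ E.tensor (F.tensor G))
      (l : ∀ {A B : CStarAlg.{u}} (E : HilbertBimodule A B), (unitBimodule A).tensor E ≅ E)
      (r : ∀ {A B : CStarAlg.{u}} (E : HilbertBimodule A B), E.tensor (unitBimodule B) ≅ E),
      (∀ {A B C : CStarAlg.{u}} (E : HilbertBimodule A B) {F F' : HilbertBimodule B C}
        (T : F ⟶ F') (x : E) (y : F), app (wl E T) (tmul x y) = tmul x (app T y)) ∧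
      (∀ {A B C : CStarAlg.{u}} {E E' : HilbertBimodule A B} (T : E ⟶ E')
        (F : HilbertBimodule B C) (x : E) (y : F),
        app (wr T F) (tmul x y) = tmul (app T x) y) ∧
      (∀ {A B C D : CStarAlg.{u}} (E : HilbertBimodule A B) (F : HilbertBimodule B C)
        (G : HilbertBimodule C D) (x : E) (y : F) (z : G),
        app (α E F G).hom (tmul (tmul x y) z) = tmul x (tmul y z)) ∧
      (∀ {A B : CStarAlg.{u}} (E : HilbertBimodule A B) (a : A) (x : E),
        app (l E).hom (tmul (E := unitBimodule A) a x) = E.leftAction a x) ∧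
      (∀ {A B : CStarAlg.{u}} (E : HilbertBimodule A B) (x : E) (b : B),
        app (r E).hom (tmul (F := unitBimodule B) x b) = HilbertModule.rsmul x b) ∧
      ∃ 𝓑 : Bicategory CStarAlg.{u}, BicategoryData.of 𝓑 =
        { Hom := HilbertBimodule
          id := unitBimodule
          comp := tensor
          homCategory := homCategory
          whiskerLeft := wl
          whiskerRight := wr
          associator := α
          leftUnitor := l
          rightUnitor := r } := by
  exact ⟨fun _ _ _ _ T x b => app_rsmul T x b, whiskerLeft, whiskerRight, associator, leftUnitor,
    rightUnitor, whiskerLeft_tmul, whiskerRight_tmul, associator_hom_tmul, leftUnitor_hom_tmul,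
    rightUnitor_hom_tmul, cstarBicategory, rfl⟩
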